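/- Let $n\ge 1$. For a real-valued $u\in L^1_{\mathrm{loc}}(\mathbb R^n)$ and a multi-index $\alpha$, let $D^\alpha u$ denote the weak derivative. For $k\in\mathbb N_0$ and $p\in[1,\infty]$ let $\|u\|_{W^{k,p}}=\big(\sum_{|\alpha|\le k}\|D^\alpha u\|_{L^p}^p\big)^{1/p}$ if $p<\infty$ and $\|u\|_{W^{k,\infty}}=\max_{|\alpha|\le k}\|D^\alpha u\|_{L^\infty}$. For $\sigma\in(0,1)$ let $$[v]_{W^{\sigma,p}}=\Big(\sigma(1-\sigma)\int_{\mathbb R^n}\int_{\mathbb R^n}\frac{|v(x)-v(y)|^p}{|x-y|^{n+\sigma p}}\,dx\,dy\Big)^{1/p}\quad(p<\infty),\qquad [v]_{W^{\sigma,\infty}}=\sup_{x\ne y}\frac{|v(x)-v(y)|}{|x-y|^{\sigma}},$$ where for $p=\infty$ the continuous representative of $v$ is used (and $[v]_{W^{\sigma,\infty}}=\infty$ if there is none). For $s\in(k,k+1)$ with $k\in\mathbb N_0$, let $[u]_{W^{s,p}}=\sup_{|\alpha|=k}[D^\alpha u]_{W^{s-k,p}}$, and let $\|u\|_{W^{s,p}}=\big(\|u\|_{W^{k,p}}^p+[u]_{W^{s,p}}^p\big)^{1/p}$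 if $p<\infty$ and $\|u\|_{W^{s,\infty}}=\max\{\|u\|_{W^{k,\infty}},[u]_{W^{s,\infty}}\}$. For $s\ge 0$ and $p\in[1,\infty]$, the Sobolev–Slobodeckij space $W^{s,p}(\mathbb R^n)$ consists of the functions $u$ for which the weak derivatives of order at most $\lfloor s\rfloor$ exist and $\|u\|_{W^{s,p}}<\infty$. **Theorem.** Let $s_0,s_1\ge 0$ and let $p_0,p_1,p\in[1,\infty]$ satisfy $\frac1p+1=\frac1{p_0}+\frac1{p_1}$ (with $\frac1\infty=0$). Then there is a constant $C<\infty$, depending only on $n,s_0,s_1,p_0,p_1$, such that for all $f\in W^{s_0,p_0}(\mathbb R^n)$ and $g\in W^{s_1,p_1}(\mathbb R^n)$ the convolution integral $(f*g)(x)=\int_{\mathbb R^n} f(y)\,g(x-y)\,dy$ converges absolutely for almost every $x$, the function $f*g$ belongs to $W^{s_0+s_1,p}(\mathbb R^n)$, and $$\|f*g\|_{W^{s_0+s_1,p}}\le C\,\|f\|_{W^{s_0,p_0}}\,\|g\|_{W^{s_1,p_1}}.$$ -/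

import Mathlib

open MeasureTheory Set
open scoped ENNReal NNReal ContDiff Convolution

noncomputable section

namespace SobolevSlobodeckij

/-- The classical partial derivative `∂ᵢ φ` of a function on `ℝⁿ`. -/
def partialDeriv {n : ℕ} (i : Fin n) (φ : EuclideanSpace ℝ (Fin n) → ℝ) :
    EuclideanSpace ℝ (Fin n) → ℝ :=
  fun x => fderiv ℝ φ x (EuclideanSpace.single i 1)

/-- The order `|α| = α₁ + ⋯ + αₙ` of a multi-index. -/
def order {n : ℕ} (α : Fin n → ℕ) : ℕ := ∑ i, α i

/-- The classical derivative `D^α φ = ∂₁^{α₁} ⋯ ∂ₙ^{αₙ} φ` (applied to smooth functions only). -/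
def multiDeriv {n : ℕ} (α : Fin n → ℕ) (φ : EuclideanSpace ℝ (Fin n) → ℝ) :
    EuclideanSpace ℝ (Fin n) → ℝ :=
  (List.finRange n).foldr (fun i ψ => (partialDeriv i)^[α i] ψ) φ

/-- `v` is (a representative of) the weak derivative `D^α u`. -/
structure IsWeakDeriv {n : ℕ} (α : Fin n → ℕ) (u v : EuclideanSpace ℝ (Fin n) → ℝ) : Prop where
  locallyIntegrable_left : LocallyIntegrable u volume
  locallyIntegrable_right : LocallyIntegrable v volume
  integral_eq : ∀ φ : EuclideanSpace ℝ (Fin n) → ℝ, ContDiff ℝ ∞ φ → HasCompactSupport φ →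
    ∫ x, u x * multiDeriv α φ x = (-1) ^ order α * ∫ x, v x * φ x

/-- Weak derivatives are unique up to null sets. -/
theorem IsWeakDeriv.ae_eq {n : ℕ} {α : Fin n → ℕ} {u v w : EuclideanSpace ℝ (Fin n) → ℝ}
    (hv : IsWeakDeriv α u v) (hw : IsWeakDeriv α u w) : v =ᵐ[volume] w := by
  refine ae_eq_of_integral_contDiff_smul_eq hv.locallyIntegrable_right
    hw.locallyIntegrable_right fun φ hφ hc => ?_
  have h := (hv.integral_eq φ hφ hc).symm.trans (hw.integral_eq φ hφ hc)
  have h' := mul_left_cancel₀ (pow_ne_zero _ (by norm_num : (-1 : ℝ) ≠ 0)) h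
  simpa only [smul_eq_mul, mul_comm] using h'

/-- `‖D^α u‖_{L^p}` for the weak derivative `D^α u`, and `∞` if `u` has no weak derivative `D^α u`.
(The infimum is over the representatives of `D^α u`, which all have the same `L^p` norm.) -/
def derivLpNorm {n : ℕ} (α : Fin n → ℕ) (p : ℝ≥0∞) (u : EuclideanSpace ℝ (Fin n) → ℝ) : ℝ≥0∞ :=
  ⨅ (v : EuclideanSpace ℝ (Fin n) → ℝ) (_ : IsWeakDeriv α u v), eLpNorm v p volume

theorem derivLpNorm_eq {n : ℕ} {α : Fin n → ℕ} (p : ℝ≥0∞)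
    {u v : EuclideanSpace ℝ (Fin n) → ℝ} (hv : IsWeakDeriv α u v) :
    derivLpNorm α p u = eLpNorm v p volume :=
  le_antisymm (iInf₂_le v hv)
    (le_iInf₂ fun _ hw => (eLpNorm_congr_ae (hv.ae_eq hw)).le)

/-- The finitely many multi-indices `α` with `|α| ≤ k`. -/
def multiIndices (n k : ℕ) : Finset (Fin n → ℕ) :=
  (Fintype.piFinset fun _ : Fin n => Finset.range (k + 1)).filter fun α => order α ≤ k

theorem mem_multiIndices {n k : ℕ} {α : Fin n → ℕ} : α ∈ multiIndices n k ↔ order α ≤ k := by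
  simp only [multiIndices, Finset.mem_filter, Fintype.mem_piFinset, Finset.mem_range,
    and_iff_right_iff_imp]
  exact fun h i => Nat.lt_succ_of_le
    ((Finset.single_le_sum (fun _ _ => Nat.zero_le _) (Finset.mem_univ i)).trans h)

/-- The norm of the integer-order Sobolev space `W^{k,p}(ℝⁿ)`; it is `∞` outside the space. -/
def sobolevNorm {n : ℕ} (k : ℕ) (p : ℝ≥0∞) (u : EuclideanSpace ℝ (Fin n) → ℝ) : ℝ≥0∞ :=
  if p = ⊤ then ⨆ α ∈ multiIndices n k, derivLpNorm α ⊤ u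
  else (∑ α ∈ multiIndices n k, derivLpNorm α p u ^ p.toReal) ^ (1 / p.toReal)

/-- The Sobolev–Slobodeckij (for `p = ∞`: Hölder) seminorm of order `σ ∈ (0,1)` of a function. -/
def gagliardoSeminorm {n : ℕ} (σ : ℝ) (p : ℝ≥0∞) (v : EuclideanSpace ℝ (Fin n) → ℝ) : ℝ≥0∞ :=
  if p = ⊤ then
    ⨆ (x : EuclideanSpace ℝ (Fin n)) (y : EuclideanSpace ℝ (Fin n)) (_ : x ≠ y),
      ‖v x - v y‖ₑ / ‖x - y‖ₑ ^ σ
  else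
    (ENNReal.ofReal (σ * (1 - σ)) *
      ∫⁻ x : EuclideanSpace ℝ (Fin n), ∫⁻ y : EuclideanSpace ℝ (Fin n),
        ‖v x - v y‖ₑ ^ p.toReal / ‖x - y‖ₑ ^ ((n : ℝ) + σ * p.toReal)) ^ (1 / p.toReal)

/-- `[D^α u]_{W^{σ,p}}` for the weak derivative `D^α u`, and `∞` if there is none. The infimum over
the representatives of `D^α u` matters only for `p = ∞`: there the supremum of the difference
quotients is taken for the continuous representative, if there is one, and is `∞` otherwise. -/
def derivGagliardoSeminorm {n : ℕ} (α : Fin n → ℕ) (σ : ℝ) (p : ℝ≥0∞)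
    (u : EuclideanSpace ℝ (Fin n) → ℝ) : ℝ≥0∞ :=
  ⨅ (v : EuclideanSpace ℝ (Fin n) → ℝ) (_ : IsWeakDeriv α u v), gagliardoSeminorm σ p v

/-- The seminorm `[u]_{W^{s,p}} = sup_{|α| = k} [D^α u]_{W^{s-k,p}}` for `s ∈ (k, k+1)`,
where `k = ⌊s⌋`. -/
def slobodeckijSeminorm {n : ℕ} (s : ℝ) (p : ℝ≥0∞) (u : EuclideanSpace ℝ (Fin n) → ℝ) : ℝ≥0∞ :=
  ⨆ (α : Fin n → ℕ) (_ : order α = ⌊s⌋₊), derivGagliardoSeminorm α (s - ⌊s⌋₊) p u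

/-- The full norm of `W^{s,p}(ℝⁿ)`, `s ≥ 0`; it is `∞` outside the space. -/
def slobodeckijNorm {n : ℕ} (s : ℝ) (p : ℝ≥0∞) (u : EuclideanSpace ℝ (Fin n) → ℝ) : ℝ≥0∞ :=
  if s = ⌊s⌋₊ then sobolevNorm ⌊s⌋₊ p u
  else if p = ⊤ then max (sobolevNorm ⌊s⌋₊ p u) (slobodeckijSeminorm s p u)
  else (sobolevNorm ⌊s⌋₊ p u ^ p.toReal + slobodeckijSeminorm s p u ^ p.toReal) ^ (1 / p.toReal)

/-- `u ∈ W^{s,p}(ℝⁿ)`: all weak derivatives entering the norm exist and the norm is finite. -/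
def MemSlobodeckij {n : ℕ} (s : ℝ) (p : ℝ≥0∞) (u : EuclideanSpace ℝ (Fin n) → ℝ) : Prop :=
  slobodeckijNorm s p u < ⊤

end SobolevSlobodeckij

end

/-!
The theorem is Young's convolution inequality combined with the fact that derivatives and
differences can be distributed over the factors of a convolution.

For integer orders, `D^{α+β} (f * g) = D^α f * D^β g` (`IsWeakDeriv.conv`), and every multi-index
of order at most `k₀ + k₁` is a sum `α + β` with `|α| ≤ k₀` and `|β| ≤ k₁`. This reduces the
general case to factors `f` and `g` whose smoothness orders are the fractional parts
`σ₀, σ₁ ∈ [0, 1)` of `s₀` and `s₁`.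

For these, the Slobodeckij seminorm of order `σ` is replaced by the equivalent dyadic form
`besov`: the `ℓ^p(ℤ)` norm of `m ↦ sup_{|h| = 2^m r} |h|^{-σ} ‖Δ_h u‖_p`, uniformly in `r > 0`,
with `Δ_h u = u(· + h) - u`. It dominates the Slobodeckij seminorm by integration over dyadic
annuli (`exists_gagliardoSeminorm_le_besov`). It is dominated by the Slobodeckij seminorm because
`‖Δ_h u‖_p` is bounded by an average of `‖Δ_k u‖_p` over increments `k` near `h / 2`
(`exists_besov_le_gagliardoSeminorm`).

Now `Δ_h Δ_k (f * g) = Δ_h f * Δ_k g`, so that Young's inequality bounds second differences of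
`f * g` by products of moduli of `f` and `g`. Since `1/p₀ + 1/p₁ = 1 + 1/p ≥ 1`, Hölder's
inequality shows that these products form a sequence in `ℓ^1 ⊆ ℓ^p`
(`tsum_modulus_mul_modulus_le`). There are three cases.

* If `σ₀ = 0` or `σ₁ = 0`, then `Δ_h (f * g) = Δ_h f * g` and the inclusion `ℓ^{p₀} ⊆ ℓ^p` suffice
  (`besov_conv_le_mul_eLpNorm`).
* If `σ₀ + σ₁ < 1`, Marchaud's inequality recovers first differences from second differences
  (`exists_besov_conv_le_of_add_lt_one`).
* If `σ₀ + σ₁ ≥ 1`, consecutive dyadic difference quotients of `f * g` differ by second differences,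
  and the bound above makes them a Cauchy sequence in `L^p`. Its limit is the partial derivative
  `∂ᵢ (f * g)` (`exists_weakDeriv_conv`), and the rate of convergence yields its seminorm of order
  `σ₀ + σ₁ - 1` (`exists_weakDeriv_conv_besov_le`).

For `p = ∞` the seminorm of `f * g` refers to a continuous representative. The factors then have
dual exponents, the convolution is defined at every point, and all bounds for it hold pointwise.
To treat all `p` at once, norms of `f * g` are taken with respect to `strictMeasure`, which is the
counting measure if `p = ∞`.
-/

noncomputable section

namespace SobolevSlobodeckij

open Filter Topology

variable {n : ℕ}

/-! ### Multi-index derivatives of smooth functions -/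

theorem contDiff_partialDeriv (i : Fin n) {φ : EuclideanSpace ℝ (Fin n) → ℝ}
    (hφ : ContDiff ℝ ∞ φ) : ContDiff ℝ ∞ (partialDeriv i φ) :=
  (hφ.fderiv_right (m := ∞) le_rfl).clm_apply contDiff_const

theorem hasCompactSupport_partialDeriv (i : Fin n) {φ : EuclideanSpace ℝ (Fin n) → ℝ}
    (hφ : HasCompactSupport φ) : HasCompactSupport (partialDeriv i φ) :=
  hφ.fderiv_apply (𝕜 := ℝ) _

theorem partialDeriv_comm (i j : Fin n) {φ : EuclideanSpace ℝ (Fin n) → ℝ}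
    (hφ : ContDiff ℝ ∞ φ) :
    partialDeriv i (partialDeriv j φ) = partialDeriv j (partialDeriv i φ) := by
  have hd : Differentiable ℝ (fderiv ℝ φ) :=
    (hφ.fderiv_right (m := ∞) le_rfl).differentiable (by simp)
  have key (a b : Fin n) (x) : partialDeriv a (partialDeriv b φ) x =
      fderiv ℝ (fderiv ℝ φ) x (EuclideanSpace.single a 1) (EuclideanSpace.single b 1) := by
    change fderiv ℝ (fun y => fderiv ℝ φ y (EuclideanSpace.single b 1)) x _ = _
    rw [fderiv_clm_apply (hd x) (differentiableAt_const _)]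
    simp
  ext x
  rw [key, key]
  refine (hφ.contDiffAt.isSymmSndFDerivAt ?_) _ _
  rw [minSmoothness_of_isRCLikeNormedField]
  exact WithTop.coe_le_coe.2 le_top

theorem partialDeriv_comp_add_right (i : Fin n) (φ : EuclideanSpace ℝ (Fin n) → ℝ)
    (h : EuclideanSpace ℝ (Fin n)) :
    partialDeriv i (fun x => φ (x + h)) = fun x => partialDeriv i φ (x + h) := by
  ext x
  simp only [partialDeriv, fderiv_comp_add_right]

/-- Iterated partial derivatives along the indices in the list `l`. -/
def listDeriv (l : List (Fin n)) (α : Fin n → ℕ) (φ : EuclideanSpace ℝ (Fin n) → ℝ) :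
    EuclideanSpace ℝ (Fin n) → ℝ :=
  l.foldr (fun i ψ => (partialDeriv i)^[α i] ψ) φ

theorem multiDeriv_eq_listDeriv (α : Fin n → ℕ) (φ : EuclideanSpace ℝ (Fin n) → ℝ) :
    multiDeriv α φ = listDeriv (List.finRange n) α φ := rfl

theorem iterate_partialDeriv_induction {P : (EuclideanSpace ℝ (Fin n) → ℝ) → Prop}
    (hP : ∀ i φ, P φ → P (partialDeriv i φ)) (i : Fin n) (k : ℕ)
    {φ : EuclideanSpace ℝ (Fin n) → ℝ} (hφ : P φ) : P ((partialDeriv i)^[k] φ) := by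
  induction k generalizing φ with
  | zero => exact hφ
  | succ k ih => exact ih (hP i φ hφ)

theorem listDeriv_induction {P : (EuclideanSpace ℝ (Fin n) → ℝ) → Prop}
    (hP : ∀ i φ, P φ → P (partialDeriv i φ)) (l : List (Fin n)) (α : Fin n → ℕ)
    {φ : EuclideanSpace ℝ (Fin n) → ℝ} (hφ : P φ) : P (listDeriv l α φ) := by
  induction l with
  | nil => exact hφ
  | cons i l ih => exact iterate_partialDeriv_induction hP i _ ih

theorem contDiff_multiDeriv (α : Fin n → ℕ) {φ : EuclideanSpace ℝ (Fin n) → ℝ}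
    (hφ : ContDiff ℝ ∞ φ) : ContDiff ℝ ∞ (multiDeriv α φ) :=
  listDeriv_induction (P := ContDiff ℝ ∞) (fun i _ h => contDiff_partialDeriv i h) _ α hφ

theorem hasCompactSupport_multiDeriv (α : Fin n → ℕ) {φ : EuclideanSpace ℝ (Fin n) → ℝ}
    (hφ : HasCompactSupport φ) : HasCompactSupport (multiDeriv α φ) :=
  listDeriv_induction (P := HasCompactSupport)
    (fun i _ h => hasCompactSupport_partialDeriv i h) _ α hφ

theorem iterate_partialDeriv_comm (i j : Fin n) (k : ℕ) {φ : EuclideanSpace ℝ (Fin n) → ℝ}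
    (hφ : ContDiff ℝ ∞ φ) :
    partialDeriv i ((partialDeriv j)^[k] φ) = (partialDeriv j)^[k] (partialDeriv i φ) := by
  induction k generalizing φ with
  | zero => rfl
  | succ k ih =>
    rw [Function.iterate_succ_apply, ih (contDiff_partialDeriv j hφ), partialDeriv_comm i j hφ,
      Function.iterate_succ_apply]

theorem partialDeriv_listDeriv_comm (i : Fin n) (l : List (Fin n)) (α : Fin n → ℕ)
    {φ : EuclideanSpace ℝ (Fin n) → ℝ} (hφ : ContDiff ℝ ∞ φ) :
    partialDeriv i (listDeriv l α φ) = listDeriv l α (partialDeriv i φ) := by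
  induction l with
  | nil => rfl
  | cons j l ih =>
    have hs : ContDiff ℝ ∞ (listDeriv l α φ) :=
      listDeriv_induction (P := ContDiff ℝ ∞) (fun i _ h => contDiff_partialDeriv i h) _ α hφ
    change partialDeriv i ((partialDeriv j)^[α j] (listDeriv l α φ)) = _
    rw [iterate_partialDeriv_comm i j _ hs, ih]
    rfl

theorem iterate_listDeriv_comm (i : Fin n) (k : ℕ) (l : List (Fin n)) (α : Fin n → ℕ)
    {φ : EuclideanSpace ℝ (Fin n) → ℝ} (hφ : ContDiff ℝ ∞ φ) :
    (partialDeriv i)^[k] (listDeriv l α φ) = listDeriv l α ((partialDeriv i)^[k] φ) := by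
  induction k generalizing φ with
  | zero => rfl
  | succ k ih =>
    rw [Function.iterate_succ_apply, partialDeriv_listDeriv_comm i l α hφ,
      ih (contDiff_partialDeriv i hφ), Function.iterate_succ_apply]

theorem listDeriv_add (l : List (Fin n)) (α β : Fin n → ℕ) {φ : EuclideanSpace ℝ (Fin n) → ℝ}
    (hφ : ContDiff ℝ ∞ φ) : listDeriv l (α + β) φ = listDeriv l α (listDeriv l β φ) := by
  induction l with
  | nil => rfl
  | cons i l ih =>
    have hs : ContDiff ℝ ∞ (listDeriv l β φ) :=
      listDeriv_induction (P := ContDiff ℝ ∞) (fun i _ h => contDiff_partialDeriv i h) _ β hφ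
    change (partialDeriv i)^[α i + β i] (listDeriv l (α + β) φ) =
      (partialDeriv i)^[α i] (listDeriv l α ((partialDeriv i)^[β i] (listDeriv l β φ)))
    rw [ih, Function.iterate_add_apply, iterate_listDeriv_comm i (β i) l α hs]

theorem multiDeriv_add (α β : Fin n → ℕ) {φ : EuclideanSpace ℝ (Fin n) → ℝ}
    (hφ : ContDiff ℝ ∞ φ) : multiDeriv (α + β) φ = multiDeriv α (multiDeriv β φ) :=
  listDeriv_add _ α β hφ

theorem multiDeriv_zero (φ : EuclideanSpace ℝ (Fin n) → ℝ) : multiDeriv 0 φ = φ := by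
  rw [multiDeriv_eq_listDeriv]
  induction List.finRange n with
  | nil => rfl
  | cons i l ih => exact ih

theorem multiDeriv_single (i : Fin n) (φ : EuclideanSpace ℝ (Fin n) → ℝ) :
    multiDeriv (Pi.single i 1) φ = partialDeriv i φ := by
  have key (l : List (Fin n)) (hl : l.Nodup) : listDeriv l (Pi.single i 1) φ =
      if i ∈ l then partialDeriv i φ else φ := by
    induction l with
    | nil => simp [listDeriv]
    | cons j l ih =>
      change (partialDeriv j)^[(Pi.single i 1 : Fin n → ℕ) j] (listDeriv l (Pi.single i 1) φ) = _
      rw [ih (List.nodup_cons.1 hl).2]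
      rcases eq_or_ne j i with rfl | hij
      · simp [(List.nodup_cons.1 hl).1]
      · simp [hij.symm]
  rw [multiDeriv_eq_listDeriv, key _ (List.nodup_finRange n)]
  simp

theorem multiDeriv_comp_add_right (α : Fin n → ℕ) (φ : EuclideanSpace ℝ (Fin n) → ℝ)
    (h : EuclideanSpace ℝ (Fin n)) :
    multiDeriv α (fun x => φ (x + h)) = fun x => multiDeriv α φ (x + h) := by
  have hit (i : Fin n) (k : ℕ) (ψ : EuclideanSpace ℝ (Fin n) → ℝ) :
      (partialDeriv i)^[k] (fun x => ψ (x + h)) = fun x => (partialDeriv i)^[k] ψ (x + h) := by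
    induction k generalizing ψ with
    | zero => rfl
    | succ k ih =>
      rw [Function.iterate_succ_apply, partialDeriv_comp_add_right, ih, Function.iterate_succ_apply]
  simp only [multiDeriv_eq_listDeriv]
  induction List.finRange n with
  | nil => rfl
  | cons i l ih =>
    change (partialDeriv i)^[α i] (listDeriv l α (fun x => φ (x + h))) = _
    rw [ih, hit]
    rfl

theorem order_add (α β : Fin n → ℕ) : order (α + β) = order α + order β := by
  simp [order, Finset.sum_add_distrib]

theorem order_zero : order (0 : Fin n → ℕ) = 0 := by simp [order]

theorem order_single (i : Fin n) : order (Pi.single i 1) = 1 := by simp [order]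

/-! ### Weak derivatives -/

theorem IsWeakDeriv.trans {α β : Fin n → ℕ} {u v w : EuclideanSpace ℝ (Fin n) → ℝ}
    (huv : IsWeakDeriv α u v) (hvw : IsWeakDeriv β v w) : IsWeakDeriv (α + β) u w where
  locallyIntegrable_left := huv.1
  locallyIntegrable_right := hvw.2
  integral_eq φ hφ hc := by
    rw [multiDeriv_add α β hφ, huv.3 _ (contDiff_multiDeriv β hφ)
      (hasCompactSupport_multiDeriv β hc), hvw.3 φ hφ hc, order_add, pow_add, mul_assoc]

theorem IsWeakDeriv.congr_right {α : Fin n → ℕ} {u v w : EuclideanSpace ℝ (Fin n) → ℝ}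
    (huv : IsWeakDeriv α u v) (h : v =ᵐ[volume] w) : IsWeakDeriv α u w where
  locallyIntegrable_left := huv.1
  locallyIntegrable_right := huv.2.congr h
  integral_eq φ hφ hc := by
    rw [huv.3 φ hφ hc]
    congr 1
    refine integral_congr_ae ?_
    filter_upwards [h] with x hx
    rw [hx]

theorem IsWeakDeriv.congr_left {α : Fin n → ℕ} {u v w : EuclideanSpace ℝ (Fin n) → ℝ}
    (huv : IsWeakDeriv α u v) (h : u =ᵐ[volume] w) : IsWeakDeriv α w v where
  locallyIntegrable_left := huv.1.congr h
  locallyIntegrable_right := huv.2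
  integral_eq φ hφ hc := by
    rw [← huv.3 φ hφ hc]
    refine integral_congr_ae ?_
    filter_upwards [h] with x hx
    rw [hx]

theorem isWeakDeriv_zero {u : EuclideanSpace ℝ (Fin n) → ℝ} (hu : LocallyIntegrable u volume) :
    IsWeakDeriv 0 u u :=
  ⟨hu, hu, fun φ _ _ => by simp [multiDeriv_zero, order_zero]⟩

theorem exists_add_of_order_eq {k l : ℕ} {γ : Fin n → ℕ} (h : order γ = k + l) :
    ∃ α β : Fin n → ℕ, γ = α + β ∧ order α = k ∧ order β = l := by
  induction l generalizing γ with
  | zero => exact ⟨γ, 0, by simp, h, order_zero⟩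
  | succ l ih =>
    obtain ⟨i, hi⟩ : ∃ i, γ i ≠ 0 := by
      by_contra! hc
      have : order γ = 0 := by simp [order, hc]
      omega
    have hγ : γ = (γ - Pi.single i 1) + Pi.single i 1 := by
      ext j
      rcases eq_or_ne j i with rfl | hj
      · simp; omega
      · simp [hj]
    have ho : order (γ - Pi.single i 1) = k + l := by
      have := order_add (γ - Pi.single i 1) (Pi.single i 1)
      rw [← hγ, order_single] at this
      omega
    obtain ⟨α, β, h1, h2, h3⟩ := ih ho
    exact ⟨α, β + Pi.single i 1, by rw [← add_assoc, ← h1, ← hγ], h2, by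
      rw [order_add, order_single, h3]⟩

theorem exists_add_of_order_le {k l : ℕ} {γ : Fin n → ℕ} (h : order γ ≤ k + l) :
    ∃ α β : Fin n → ℕ, γ = α + β ∧ order α ≤ k ∧ order β ≤ l := by
  rcases le_total (order γ) k with hk | hk
  · exact ⟨γ, 0, by simp, hk, by simp [order_zero]⟩
  · obtain ⟨α, β, h1, h2, h3⟩ := exists_add_of_order_eq (k := k) (l := order γ - k) (γ := γ)
      (by omega)
    exact ⟨α, β, h1, h2.le, by omega⟩

/-! ### Young's convolution inequality -/

/-- Young's inequality for nonnegative functions and finite exponents: Hölder's inequality with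
the exponents `c`, `1 / (1 - 1/b)` and `1 / (1 - 1/a)` is applied to a factorization of
`f y * g (x - y)` into the `c`-th root of `f y ^ a * g (x - y) ^ b` and powers of the two factors. -/
theorem lintegral_lconvolution_rpow_le {f g : EuclideanSpace ℝ (Fin n) → ℝ≥0∞}
    (hf : Measurable f) (hg : Measurable g) {a b c : ℝ} (ha : 1 ≤ a) (hb : 1 ≤ b) (hc : 1 ≤ c)
    (habc : c⁻¹ + 1 = a⁻¹ + b⁻¹) :
    ∫⁻ x, (∫⁻ y, f y * g (x - y)) ^ c ≤
      ((∫⁻ x, f x ^ a) ^ (1 / a) * (∫⁻ x, g x ^ b) ^ (1 / b)) ^ c := by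
  have ha0 : 0 < a := by linarith
  have hb0 : 0 < b := by linarith
  have hc0 : 0 < c := by linarith
  have ha' : 0 ≤ 1 - a⁻¹ := sub_nonneg.2 (inv_le_one_of_one_le₀ ha)
  have hb' : 0 ≤ 1 - b⁻¹ := sub_nonneg.2 (inv_le_one_of_one_le₀ hb)
  have hc' : 0 ≤ c⁻¹ := by positivity
  have ea : a * c⁻¹ + a * (1 - b⁻¹) = 1 := by
    rw [← mul_add, show c⁻¹ + (1 - b⁻¹) = a⁻¹ by linarith, mul_inv_cancel₀ ha0.ne']
  have eb : b * c⁻¹ + b * (1 - a⁻¹) = 1 := by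
    rw [← mul_add, show c⁻¹ + (1 - a⁻¹) = b⁻¹ by linarith, mul_inv_cancel₀ hb0.ne']
  set A := ∫⁻ x, f x ^ a with hA
  set B := ∫⁻ x, g x ^ b with hB
  -- the exponents of `s` and of `t` on the right add up to one by `ea` and `eb`
  have hsplit (s t : ℝ≥0∞) : s * t =
      (s ^ a * t ^ b) ^ c⁻¹ * ((s ^ a) ^ (1 - b⁻¹) * (t ^ b) ^ (1 - a⁻¹)) := by
    rw [ENNReal.mul_rpow_of_nonneg _ _ hc', ← ENNReal.rpow_mul, ← ENNReal.rpow_mul,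
      ← ENNReal.rpow_mul, ← ENNReal.rpow_mul, mul_mul_mul_comm,
      ← ENNReal.rpow_add_of_nonneg _ _ (by positivity) (by positivity),
      ← ENNReal.rpow_add_of_nonneg _ _ (by positivity) (by positivity), ea, eb,
      ENNReal.rpow_one, ENNReal.rpow_one]
  have hpt (x : EuclideanSpace ℝ (Fin n)) : ∫⁻ y, f y * g (x - y) ≤
      (∫⁻ y, f y ^ a * g (x - y) ^ b) ^ c⁻¹ * (A ^ (1 - b⁻¹) * B ^ (1 - a⁻¹)) := by
    have hB' : B = ∫⁻ y, g (x - y) ^ b :=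
      (lintegral_sub_left_eq_self (fun y => g y ^ b) x).symm
    have h := ENNReal.lintegral_prod_norm_pow_le (μ := volume) Finset.univ
      (f := ![fun y => f y ^ a * g (x - y) ^ b, fun y => f y ^ a, fun y => g (x - y) ^ b])
      (p := ![c⁻¹, 1 - b⁻¹, 1 - a⁻¹])
      (by
        intro i _
        fin_cases i
        · exact ((hf.pow_const _).mul
            ((hg.comp (measurable_const.sub measurable_id)).pow_const _)).aemeasurable
        · exact (hf.pow_const _).aemeasurable
        · exact ((hg.comp (measurable_const.sub measurable_id)).pow_const _).aemeasurable)
      (by simp [Fin.sum_univ_three]; linarith)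
      (by
        intro i _
        fin_cases i
        · exact hc'
        · exact hb'
        · exact ha')
    simp only [Fin.prod_univ_three, Matrix.cons_val_zero, Matrix.cons_val_one,
      Matrix.cons_val] at h
    rw [← hA, ← hB', mul_assoc] at h
    refine le_trans (le_of_eq ?_) h
    refine lintegral_congr fun y => ?_
    rw [mul_assoc]
    exact hsplit _ _
  have hK : ∫⁻ x, ∫⁻ y, f y ^ a * g (x - y) ^ b = A * B := by
    rw [lintegral_lintegral_swap]
    · have (y : EuclideanSpace ℝ (Fin n)) : ∫⁻ x, f y ^ a * g (x - y) ^ b = f y ^ a * B := by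
        have hm : Measurable fun x => g (x - y) ^ b :=
          (hg.comp (measurable_id.sub_const y)).pow_const b
        rw [lintegral_const_mul _ hm, hB]
        congr 1
        exact lintegral_sub_right_eq_self (fun x => g x ^ b) y
      simp_rw [this]
      rw [lintegral_mul_const _ (hf.pow_const _)]
    · exact (((hf.comp measurable_snd).pow_const _).mul
        ((hg.comp (measurable_fst.sub measurable_snd)).pow_const _)).aemeasurable
  have hKm : Measurable fun x => ∫⁻ y, f y ^ a * g (x - y) ^ b :=
    Measurable.lintegral_prod_right' (f := fun z : EuclideanSpace ℝ (Fin n) ×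
        EuclideanSpace ℝ (Fin n) => f z.2 ^ a * g (z.1 - z.2) ^ b)
      (((hf.comp measurable_snd).pow_const _).mul
        ((hg.comp (measurable_fst.sub measurable_snd)).pow_const _))
  calc ∫⁻ x, (∫⁻ y, f y * g (x - y)) ^ c
      ≤ ∫⁻ x, (∫⁻ y, f y ^ a * g (x - y) ^ b) * (A ^ (1 - b⁻¹) * B ^ (1 - a⁻¹)) ^ c := by
        refine lintegral_mono fun x => ?_
        refine (ENNReal.rpow_le_rpow (hpt x) hc0.le).trans (le_of_eq ?_)
        rw [ENNReal.mul_rpow_of_nonneg _ _ hc0.le, ← ENNReal.rpow_mul, inv_mul_cancel₀ hc0.ne',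
          ENNReal.rpow_one]
    _ = A * B * (A ^ (1 - b⁻¹) * B ^ (1 - a⁻¹)) ^ c := by
        rw [lintegral_mul_const _ hKm, hK]
    _ = ((A * B) ^ c⁻¹ * (A ^ (1 - b⁻¹) * B ^ (1 - a⁻¹))) ^ c := by
        rw [ENNReal.mul_rpow_of_nonneg ((A * B) ^ c⁻¹) _ hc0.le, ← ENNReal.rpow_mul (A * B),
          inv_mul_cancel₀ hc0.ne', ENNReal.rpow_one]
    _ = (A ^ (1 / a) * B ^ (1 / b)) ^ c := by
        rw [ENNReal.mul_rpow_of_nonneg _ _ hc', mul_mul_mul_comm,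
          ← ENNReal.rpow_add_of_nonneg _ _ hc' hb', ← ENNReal.rpow_add_of_nonneg _ _ hc' ha',
          show c⁻¹ + (1 - b⁻¹) = 1 / a by rw [one_div]; linarith,
          show c⁻¹ + (1 - a⁻¹) = 1 / b by rw [one_div]; linarith]

/-- The measure whose `L^p` norm is used for convolutions: Lebesgue measure if `p < ∞` and the
counting measure if `p = ∞`, so that for `p = ∞` the norm is the supremum over all points and
almost everywhere means everywhere. This keeps track of continuous representatives. -/
def strictMeasure (n : ℕ) (p : ℝ≥0∞) : Measure (EuclideanSpace ℝ (Fin n)) :=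
  if p = ⊤ then Measure.count else volume

theorem strictMeasure_top : strictMeasure n ⊤ = Measure.count := if_pos rfl

theorem strictMeasure_of_ne_top {p : ℝ≥0∞} (hp : p ≠ ⊤) : strictMeasure n p = volume := if_neg hp

theorem volume_absolutelyContinuous_strictMeasure (p : ℝ≥0∞) :
    (volume : Measure (EuclideanSpace ℝ (Fin n))) ≪ strictMeasure n p := by
  rcases eq_or_ne p ⊤ with rfl | hp
  · rw [strictMeasure_top]
    refine Measure.AbsolutelyContinuous.mk fun s _ h => ?_
    rw [Measure.count_eq_zero_iff.1 h, measure_empty]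
  · rw [strictMeasure_of_ne_top hp]

theorem eLpNorm_volume_le_strictMeasure {ε : Type*} [ENorm ε] (u : EuclideanSpace ℝ (Fin n) → ε)
    (p : ℝ≥0∞) :
    eLpNorm u p volume ≤ eLpNorm u p (strictMeasure n p) := by
  rcases eq_or_ne p ⊤ with rfl | hp
  · simp only [eLpNorm_exponent_top]
    exact essSup_mono_measure (volume_absolutelyContinuous_strictMeasure ⊤)
  · rw [strictMeasure_of_ne_top hp]

theorem measurePreserving_add_right_strictMeasure (p : ℝ≥0∞) (h : EuclideanSpace ℝ (Fin n)) :
    MeasurePreserving (fun x => x + h) (strictMeasure n p) (strictMeasure n p) := by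
  rcases eq_or_ne p ⊤ with rfl | hp
  · rw [strictMeasure_top]
    exact measurePreserving_add_right Measure.count h
  · rw [strictMeasure_of_ne_top hp]
    exact measurePreserving_add_right volume h

/-- The convolution of the absolute values. -/
def enormConv (f g : EuclideanSpace ℝ (Fin n) → ℝ) (x : EuclideanSpace ℝ (Fin n)) : ℝ≥0∞ :=
  ∫⁻ y, ‖f y‖ₑ * ‖g (x - y)‖ₑ

theorem measurable_enormConv {f g : EuclideanSpace ℝ (Fin n) → ℝ} (hf : Measurable f)
    (hg : Measurable g) : Measurable (enormConv f g) :=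
  Measurable.lintegral_prod_right' (f := fun z : EuclideanSpace ℝ (Fin n) ×
      EuclideanSpace ℝ (Fin n) => ‖f z.2‖ₑ * ‖g (z.1 - z.2)‖ₑ)
    ((hf.comp measurable_snd).enorm.mul (hg.comp (measurable_fst.sub measurable_snd)).enorm)

/-- The exponents admissible in Young's convolution inequality. -/
structure YoungTriple (p₀ p₁ p : ℝ≥0∞) : Prop where
  one_le_left : 1 ≤ p₀
  one_le_right : 1 ≤ p₁
  one_le : 1 ≤ p
  inv_add_one : p⁻¹ + 1 = p₀⁻¹ + p₁⁻¹

namespace YoungTriple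

variable {p₀ p₁ p : ℝ≥0∞}

theorem symm (h : YoungTriple p₀ p₁ p) : YoungTriple p₁ p₀ p :=
  ⟨h.2, h.1, h.3, by rw [h.4, add_comm]⟩

theorem ne_top_left (h : YoungTriple p₀ p₁ p) (hp : p ≠ ⊤) : p₀ ≠ ⊤ := by
  rintro rfl
  have hpp := h.inv_add_one
  rw [ENNReal.inv_top, zero_add] at hpp
  have h1 : p⁻¹ + 1 ≤ 0 + 1 := by
    rw [hpp, zero_add]
    exact ENNReal.inv_le_one.2 h.one_le_right
  have h2 : p⁻¹ ≤ 0 := (ENNReal.add_le_add_iff_right ENNReal.one_ne_top).1 h1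
  exact hp (ENNReal.inv_eq_zero.1 (le_antisymm h2 zero_le))

theorem left_le (h : YoungTriple p₀ p₁ p) : p₀ ≤ p := by
  rw [← ENNReal.inv_le_inv, ← ENNReal.add_le_add_iff_right ENNReal.one_ne_top, h.inv_add_one]
  gcongr
  exact ENNReal.inv_le_one.2 h.one_le_right

theorem toReal_inv (h : YoungTriple p₀ p₁ p) :
    p.toReal⁻¹ + 1 = p₀.toReal⁻¹ + p₁.toReal⁻¹ := by
  have ht {q : ℝ≥0∞} (hq : 1 ≤ q) : q⁻¹ ≠ ⊤ :=
    ENNReal.inv_ne_top.2 (zero_lt_one.trans_le hq).ne'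
  have := congrArg ENNReal.toReal h.inv_add_one
  rw [ENNReal.toReal_add (ht h.one_le) ENNReal.one_ne_top,
    ENNReal.toReal_add (ht h.one_le_left) (ht h.one_le_right)] at this
  simpa [ENNReal.toReal_inv] using this

end YoungTriple

theorem one_le_toReal {q : ℝ≥0∞} (hq : 1 ≤ q) (hqt : q ≠ ⊤) : 1 ≤ q.toReal := by
  simpa using ENNReal.toReal_mono hqt hq

/-- Young's convolution inequality. For `p = ∞` it is a pointwise bound. -/
theorem eLpNorm_enormConv_le {f g : EuclideanSpace ℝ (Fin n) → ℝ} (hf : Measurable f)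
    (hg : Measurable g) {p₀ p₁ p : ℝ≥0∞} (hY : YoungTriple p₀ p₁ p) :
    eLpNorm (enormConv f g) p (strictMeasure n p) ≤
      eLpNorm f p₀ volume * eLpNorm g p₁ volume := by
  rcases eq_or_ne p ⊤ with rfl | hpt
  · rw [strictMeasure_top, eLpNorm_exponent_top, eLpNormEssSup_count]
    refine iSup_le fun x => ?_
    rw [enorm_eq_self]
    have hT : ENNReal.HolderTriple p₀ p₁ 1 := ⟨by simpa using hY.inv_add_one.symm⟩
    have h := eLpNorm_smul_le_mul_eLpNorm (μ := volume) (p := p₀) (q := p₁) (r := 1)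
      (f := g ∘ fun y => x - y) (hg.comp (measurable_const.sub measurable_id)).aestronglyMeasurable
      hf.aestronglyMeasurable
    rw [eLpNorm_one_eq_lintegral_enorm] at h
    have hg' : eLpNorm (g ∘ fun y => x - y) p₁ volume = eLpNorm g p₁ volume :=
      eLpNorm_comp_measurePreserving hg.aestronglyMeasurable
        (volume.measurePreserving_sub_left x)
    rw [hg'] at h
    refine le_trans (le_of_eq ?_) h
    refine lintegral_congr fun y => ?_
    simp [enorm_mul]
  · obtain ⟨hp₀, hp₁, hp, -⟩ := id hY
    have hp₀t : p₀ ≠ ⊤ := hY.ne_top_left hpt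
    have hp₁t : p₁ ≠ ⊤ := hY.symm.ne_top_left hpt
    have hz {q : ℝ≥0∞} (hq : 1 ≤ q) : q ≠ 0 := (zero_lt_one.trans_le hq).ne'
    have hc0 : 0 < p.toReal := zero_lt_one.trans_le (one_le_toReal hp hpt)
    rw [strictMeasure_of_ne_top hpt, eLpNorm_eq_lintegral_rpow_enorm_toReal (hz hp) hpt,
      eLpNorm_eq_lintegral_rpow_enorm_toReal (hz hp₀) hp₀t,
      eLpNorm_eq_lintegral_rpow_enorm_toReal (hz hp₁) hp₁t]
    have h := lintegral_lconvolution_rpow_le hf.enorm hg.enorm (one_le_toReal hp₀ hp₀t)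
      (one_le_toReal hp₁ hp₁t)
      (one_le_toReal hp hpt) hY.toReal_inv
    have h' := ENNReal.rpow_le_rpow h (one_div_nonneg.2 hc0.le)
    rw [← ENNReal.rpow_mul _ p.toReal, mul_one_div_cancel hc0.ne', ENNReal.rpow_one] at h'
    exact h'

/-! ### Convolutions of functions in Lebesgue spaces -/

/-- The convolution `f * g` of real-valued functions on `ℝⁿ`. -/
abbrev conv (f g : EuclideanSpace ℝ (Fin n) → ℝ) : EuclideanSpace ℝ (Fin n) → ℝ :=
  f ⋆[ContinuousLinearMap.mul ℝ ℝ, volume] g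

theorem conv_apply (f g : EuclideanSpace ℝ (Fin n) → ℝ) (x : EuclideanSpace ℝ (Fin n)) :
    conv f g x = ∫ t, f t * g (x - t) := rfl

theorem conv_comm (f g : EuclideanSpace ℝ (Fin n) → ℝ) : conv f g = conv g f := by
  ext x
  rw [conv_apply, ← integral_sub_left_eq_self _ volume x]
  simp [conv_apply, mul_comm]

/-- The convolution does not see null sets at all: the two sides agree at every point. -/
theorem conv_congr {f f' g g' : EuclideanSpace ℝ (Fin n) → ℝ} (hf : f =ᵐ[volume] f')
    (hg : g =ᵐ[volume] g') : conv f g = conv f' g' :=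
  convolution_congr _ hf hg

theorem convolutionExistsAt_congr {f f' g g' : EuclideanSpace ℝ (Fin n) → ℝ}
    (hf : f =ᵐ[volume] f') (hg : g =ᵐ[volume] g') {x : EuclideanSpace ℝ (Fin n)}
    (h : ConvolutionExistsAt f' g' x (ContinuousLinearMap.mul ℝ ℝ) volume) :
    ConvolutionExistsAt f g x (ContinuousLinearMap.mul ℝ ℝ) volume := by
  refine (integrable_congr ?_).2 h
  have hg' : (fun t => g (x - t)) =ᵐ[volume] fun t => g' (x - t) :=
    (volume.measurePreserving_sub_left x).quasiMeasurePreserving.ae_eq_comp hg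
  filter_upwards [hf, hg'] with t h1 h2
  simp only [ContinuousLinearMap.mul_apply', h1, h2]

theorem measurable_conv {f g : EuclideanSpace ℝ (Fin n) → ℝ} (hf : Measurable f)
    (hg : Measurable g) : Measurable (conv f g) := by
  refine StronglyMeasurable.measurable (StronglyMeasurable.integral_prod_right'
    (f := fun z : EuclideanSpace ℝ (Fin n) × EuclideanSpace ℝ (Fin n) => f z.2 * g (z.1 - z.2)) ?_)
  exact ((hf.comp measurable_snd).mul
    (hg.comp (measurable_fst.sub measurable_snd))).stronglyMeasurable

theorem enorm_conv_le (f g : EuclideanSpace ℝ (Fin n) → ℝ) (x : EuclideanSpace ℝ (Fin n)) :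
    ‖conv f g x‖ₑ ≤ enormConv f g x := by
  refine (enorm_integral_le_lintegral_enorm _).trans (le_of_eq ?_)
  simp [enormConv, enorm_mul]

theorem eLpNorm_conv_le {f g : EuclideanSpace ℝ (Fin n) → ℝ} (hf : Measurable f)
    (hg : Measurable g) {p₀ p₁ p : ℝ≥0∞} (hY : YoungTriple p₀ p₁ p) :
    eLpNorm (conv f g) p (strictMeasure n p) ≤ eLpNorm f p₀ volume * eLpNorm g p₁ volume :=
  (eLpNorm_mono_enorm fun x => by simpa using enorm_conv_le f g x).trans
    (eLpNorm_enormConv_le hf hg hY)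

theorem ae_lt_top_of_eLpNorm_lt_top {α : Type*} [MeasurableSpace α] {μ : Measure α}
    {u : α → ℝ≥0∞} (hu : AEMeasurable u μ) {p : ℝ≥0∞} (hp : p ≠ 0) (h : eLpNorm u p μ < ⊤) :
    ∀ᵐ x ∂μ, u x < ⊤ := by
  rcases eq_or_ne p ⊤ with rfl | hpt
  · rw [eLpNorm_exponent_top] at h
    filter_upwards [enorm_ae_le_eLpNormEssSup u μ] with x hx
    exact (by simpa using hx : u x ≤ _).trans_lt h
  · have h' := lintegral_rpow_enorm_lt_top_of_eLpNorm_lt_top hp hpt h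
    have hpos := ENNReal.toReal_pos hp hpt
    filter_upwards [ae_lt_top' (hu.enorm.pow_const _) h'.ne] with x hx
    simpa using (ENNReal.rpow_lt_top_iff_of_pos hpos).1 hx

theorem ae_convolutionExistsAt {f g : EuclideanSpace ℝ (Fin n) → ℝ} (hf : Measurable f)
    (hg : Measurable g) {p₀ p₁ p : ℝ≥0∞} (hY : YoungTriple p₀ p₁ p)
    (hfp : eLpNorm f p₀ volume < ⊤) (hgp : eLpNorm g p₁ volume < ⊤) :
    ∀ᵐ x ∂strictMeasure n p, ConvolutionExistsAt f g x (ContinuousLinearMap.mul ℝ ℝ) volume := by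
  have h := ae_lt_top_of_eLpNorm_lt_top (measurable_enormConv hf hg).aemeasurable
    (zero_lt_one.trans_le hY.one_le).ne'
    ((eLpNorm_enormConv_le hf hg hY).trans_lt (ENNReal.mul_lt_top hfp hgp))
  filter_upwards [h] with x hx
  refine ⟨(hf.mul (hg.comp (measurable_const.sub measurable_id))).aestronglyMeasurable, ?_⟩
  refine lt_of_le_of_lt (le_of_eq ?_) hx
  simp [enormConv, enorm_mul]

theorem locallyIntegrable_of_eLpNorm_lt_top {u : EuclideanSpace ℝ (Fin n) → ℝ} (hu : Measurable u)
    {p : ℝ≥0∞} (hp : 1 ≤ p) (h : eLpNorm u p volume < ⊤) : LocallyIntegrable u volume :=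
  MemLp.locallyIntegrable ⟨hu.aestronglyMeasurable, h⟩ hp

/-- Fubini's theorem for a convolution tested against `ψ`. In this form, the weak derivatives of `g`
can be transferred to the translated test function. -/
theorem integral_conv_mul {f g ψ : EuclideanSpace ℝ (Fin n) → ℝ} (hf : Measurable f)
    (hg : Measurable g) {p₀ p₁ p : ℝ≥0∞} (hY : YoungTriple p₀ p₁ p)
    (hfp : eLpNorm f p₀ volume < ⊤) (hgp : eLpNorm g p₁ volume < ⊤) (hψ : Continuous ψ)
    (hc : HasCompactSupport ψ) :
    ∫ x, conv f g x * ψ x = ∫ y, f y * ∫ z, g z * ψ (z + y) := by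
  obtain ⟨B, hB⟩ := hc.exists_bound_of_continuous hψ
  have hfin : eLpNorm (enormConv f g) p volume < ⊤ :=
    ((eLpNorm_volume_le_strictMeasure _ p).trans (eLpNorm_enormConv_le hf hg hY)).trans_lt
      (ENNReal.mul_lt_top hfp hgp)
  set K := tsupport ψ
  have hK : IsCompact K := hc
  have hloc : ∫⁻ x in K, enormConv f g x < ⊤ := by
    have h1 := eLpNorm_le_eLpNorm_mul_rpow_measure_univ hY.one_le
      (f := enormConv f g) (μ := volume.restrict K)
      (measurable_enormConv hf hg).aestronglyMeasurable
    rw [eLpNorm_one_eq_lintegral_enorm] at h1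
    simp only [enorm_eq_self] at h1
    refine h1.trans_lt (ENNReal.mul_lt_top ((eLpNorm_restrict_le _ _ _ _).trans_lt hfin) ?_)
    refine ENNReal.rpow_lt_top_of_nonneg ?_ (by simpa using hK.measure_lt_top.ne)
    simpa using ENNReal.toReal_mono (by simp) (ENNReal.inv_le_one.2 hY.one_le)
  have hint : Integrable (fun z : EuclideanSpace ℝ (Fin n) × EuclideanSpace ℝ (Fin n) =>
      f z.2 * g (z.1 - z.2) * ψ z.1) (volume.prod volume) := by
    have hm : Measurable (fun z : EuclideanSpace ℝ (Fin n) × EuclideanSpace ℝ (Fin n) =>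
      f z.2 * g (z.1 - z.2) * ψ z.1) :=
      ((hf.comp measurable_snd).mul (hg.comp (measurable_fst.sub measurable_snd))).mul
        (hψ.measurable.comp measurable_fst)
    refine ⟨hm.aestronglyMeasurable, ?_⟩
    rw [HasFiniteIntegral, lintegral_prod _ hm.enorm.aemeasurable]
    calc ∫⁻ x, ∫⁻ y, ‖f y * g (x - y) * ψ x‖ₑ
        ≤ ∫⁻ x, K.indicator (fun x => ENNReal.ofReal B * enormConv f g x) x := by
          refine lintegral_mono fun x => ?_
          by_cases hx : x ∈ K
          · rw [indicator_of_mem hx, enormConv, ← lintegral_const_mul]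
            · refine lintegral_mono fun y => ?_
              rw [enorm_mul, enorm_mul, mul_comm]
              gcongr
              rw [← ofReal_norm]
              exact ENNReal.ofReal_le_ofReal (hB x)
            · exact hf.enorm.mul (hg.comp (measurable_const.sub measurable_id)).enorm
          · simp [image_eq_zero_of_notMem_tsupport hx]
      _ = ENNReal.ofReal B * ∫⁻ x in K, enormConv f g x := by
          rw [lintegral_indicator hK.measurableSet,
            lintegral_const_mul _ (measurable_enormConv hf hg)]
      _ < ⊤ := ENNReal.mul_lt_top ENNReal.ofReal_lt_top hloc
  calc ∫ x, conv f g x * ψ x = ∫ x, ∫ y, f y * g (x - y) * ψ x := by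
        refine integral_congr_ae (Eventually.of_forall fun x => ?_)
        simp only [conv_apply]
        rw [integral_mul_const]
    _ = ∫ y, ∫ x, f y * g (x - y) * ψ x := integral_integral_swap hint
    _ = ∫ y, f y * ∫ z, g z * ψ (z + y) := by
        refine integral_congr_ae (Eventually.of_forall fun y => ?_)
        simp only [mul_assoc]
        rw [integral_const_mul, ← integral_sub_right_eq_self (fun z => g z * ψ (z + y)) y]
        simp

theorem locallyIntegrable_conv {f g : EuclideanSpace ℝ (Fin n) → ℝ} (hf : Measurable f)
    (hg : Measurable g) {p₀ p₁ p : ℝ≥0∞} (hY : YoungTriple p₀ p₁ p)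
    (hfp : eLpNorm f p₀ volume < ⊤) (hgp : eLpNorm g p₁ volume < ⊤) :
    LocallyIntegrable (conv f g) volume :=
  locallyIntegrable_of_eLpNorm_lt_top (measurable_conv hf hg) hY.one_le
    ((eLpNorm_volume_le_strictMeasure _ p).trans_lt
      ((eLpNorm_conv_le hf hg hY).trans_lt (ENNReal.mul_lt_top hfp hgp)))

/-- A weak derivative can be taken on one factor of a convolution; only the integrability of the
other factor is used. -/
theorem IsWeakDeriv.conv_right {α : Fin n → ℕ} {f g g' : EuclideanSpace ℝ (Fin n) → ℝ}
    (h : IsWeakDeriv α g g') (hf : Measurable f) (hg : Measurable g) (hg' : Measurable g')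
    {p₀ p₁ p : ℝ≥0∞} (hY : YoungTriple p₀ p₁ p) (hfp : eLpNorm f p₀ volume < ⊤)
    (hgp : eLpNorm g p₁ volume < ⊤) (hgp' : eLpNorm g' p₁ volume < ⊤) :
    IsWeakDeriv α (conv f g) (conv f g') where
  locallyIntegrable_left := locallyIntegrable_conv hf hg hY hfp hgp
  locallyIntegrable_right := locallyIntegrable_conv hf hg' hY hfp hgp'
  integral_eq φ hφ hc := by
    rw [integral_conv_mul hf hg hY hfp hgp (contDiff_multiDeriv α hφ).continuous
      (hasCompactSupport_multiDeriv α hc), integral_conv_mul hf hg' hY hfp hgp' hφ.continuous hc,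
      ← integral_const_mul]
    refine integral_congr_ae (Eventually.of_forall fun y => ?_)
    have := h.integral_eq (fun x => φ (x + y)) (hφ.comp (contDiff_id.add contDiff_const))
      (hc.comp_homeomorph (Homeomorph.addRight y))
    rw [multiDeriv_comp_add_right] at this
    simp only [this]
    ring

theorem IsWeakDeriv.conv {α β : Fin n → ℕ} {f f' g g' : EuclideanSpace ℝ (Fin n) → ℝ}
    (h : IsWeakDeriv α f f') (h' : IsWeakDeriv β g g') (hf : Measurable f) (hf' : Measurable f')
    (hg : Measurable g) (hg' : Measurable g')
    {p₀ p₁ p : ℝ≥0∞} (hY : YoungTriple p₀ p₁ p) (hfp : eLpNorm f p₀ volume < ⊤)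
    (hfp' : eLpNorm f' p₀ volume < ⊤)
    (hgp : eLpNorm g p₁ volume < ⊤) (hgp' : eLpNorm g' p₁ volume < ⊤) :
    IsWeakDeriv (α + β) (SobolevSlobodeckij.conv f g) (SobolevSlobodeckij.conv f' g') := by
  rw [conv_comm f, conv_comm f']
  refine (h.conv_right hg hf hf' hY.symm hgp hfp hfp').trans ?_
  rw [conv_comm g, conv_comm g']
  exact h'.conv_right hf' hg hg' hY hfp' hgp hgp'

/-! ### Differences -/

/-- The difference `x ↦ u (x + h) - u x`. -/
def diff (h : EuclideanSpace ℝ (Fin n)) (u : EuclideanSpace ℝ (Fin n) → ℝ) :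
    EuclideanSpace ℝ (Fin n) → ℝ := fun x => u (x + h) - u x

theorem measurable_diff (h : EuclideanSpace ℝ (Fin n)) {u : EuclideanSpace ℝ (Fin n) → ℝ}
    (hu : Measurable u) : Measurable (diff h u) :=
  (hu.comp (measurable_add_const h)).sub hu

theorem diff_congr (p : ℝ≥0∞) (h : EuclideanSpace ℝ (Fin n))
    {u v : EuclideanSpace ℝ (Fin n) → ℝ} (huv : u =ᵐ[strictMeasure n p] v) :
    diff h u =ᵐ[strictMeasure n p] diff h v := by
  filter_upwards [huv, (measurePreserving_add_right_strictMeasure p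
    h).quasiMeasurePreserving.ae_eq_comp huv] with x h1 h2
  simp only [Function.comp_apply] at h2
  simp only [diff, h1, h2]

theorem eLpNorm_comp_add_right (p : ℝ≥0∞) (h : EuclideanSpace ℝ (Fin n))
    {u : EuclideanSpace ℝ (Fin n) → ℝ} (hu : Measurable u) :
    eLpNorm (fun x => u (x + h)) p (strictMeasure n p) = eLpNorm u p (strictMeasure n p) :=
  eLpNorm_comp_measurePreserving hu.aestronglyMeasurable
    (measurePreserving_add_right_strictMeasure p h)

theorem eLpNorm_diff_le {p : ℝ≥0∞} (hp : 1 ≤ p) (h : EuclideanSpace ℝ (Fin n))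
    {u : EuclideanSpace ℝ (Fin n) → ℝ} (hu : Measurable u) :
    eLpNorm (diff h u) p (strictMeasure n p) ≤ 2 * eLpNorm u p (strictMeasure n p) := by
  refine (eLpNorm_sub_le (hu.comp (measurable_add_const h)).aestronglyMeasurable
    hu.aestronglyMeasurable hp).trans (le_of_eq ?_)
  rw [two_mul]
  congr 1
  exact eLpNorm_comp_add_right p h hu

/-- For `p = ∞` the identity holds at every point, `strictMeasure` being the counting measure. -/
theorem conv_diff_left {f g : EuclideanSpace ℝ (Fin n) → ℝ} (hf : Measurable f)
    (hg : Measurable g) {p₀ p₁ p : ℝ≥0∞} (hY : YoungTriple p₀ p₁ p)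
    (hfp : eLpNorm f p₀ volume < ⊤) (hgp : eLpNorm g p₁ volume < ⊤)
    (h : EuclideanSpace ℝ (Fin n)) :
    diff h (conv f g) =ᵐ[strictMeasure n p] conv (diff h f) g := by
  have hex := ae_convolutionExistsAt hf hg hY hfp hgp
  filter_upwards [hex, (measurePreserving_add_right_strictMeasure p
    h).quasiMeasurePreserving.ae hex] with x h1 h2
  have h3 : Integrable (fun t => f (t + h) * g (x - t)) volume := by
    have := (h2.integrable).comp_add_right h
    simpa only [ContinuousLinearMap.mul_apply', add_sub_add_right_eq_sub] using this
  have h4 : conv f g (x + h) = ∫ t, f (t + h) * g (x - t) := by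
    rw [conv_apply, ← integral_add_right_eq_self _ h]
    simp only [add_sub_add_right_eq_sub]
  have h5 : Integrable (fun t => f t * g (x - t)) volume := h1
  simp only [diff, conv_apply, sub_mul]
  rw [integral_sub h3 h5, ← h4]
  rfl

theorem conv_diff_right {f g : EuclideanSpace ℝ (Fin n) → ℝ} (hf : Measurable f)
    (hg : Measurable g) {p₀ p₁ p : ℝ≥0∞} (hY : YoungTriple p₀ p₁ p)
    (hfp : eLpNorm f p₀ volume < ⊤) (hgp : eLpNorm g p₁ volume < ⊤)
    (h : EuclideanSpace ℝ (Fin n)) :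
    diff h (conv f g) =ᵐ[strictMeasure n p] conv f (diff h g) := by
  rw [conv_comm f, conv_comm f]
  exact conv_diff_left hg hf hY.symm hgp hfp h

theorem eLpNorm_diff_conv_le {f g : EuclideanSpace ℝ (Fin n) → ℝ} (hf : Measurable f)
    (hg : Measurable g) {p₀ p₁ p : ℝ≥0∞} (hY : YoungTriple p₀ p₁ p)
    (hfp : eLpNorm f p₀ volume < ⊤) (hgp : eLpNorm g p₁ volume < ⊤)
    (h : EuclideanSpace ℝ (Fin n)) :
    eLpNorm (diff h (conv f g)) p (strictMeasure n p) ≤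
      eLpNorm (diff h f) p₀ volume * eLpNorm g p₁ volume := by
  rw [eLpNorm_congr_ae (conv_diff_left hf hg hY hfp hgp h)]
  exact eLpNorm_conv_le (measurable_diff h hf) hg hY

theorem eLpNorm_diff_lt_top {p : ℝ≥0∞} (h : EuclideanSpace ℝ (Fin n))
    {u : EuclideanSpace ℝ (Fin n) → ℝ} (hu : Measurable u) (hup : eLpNorm u p volume < ⊤) :
    eLpNorm (diff h u) p volume < ⊤ := by
  have hm : MemLp u p volume := ⟨hu.aestronglyMeasurable, hup⟩
  exact ((hm.comp_measurePreserving (measurePreserving_add_right volume h)).sub hm).2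

/-- A second difference of a convolution is the convolution of first differences. -/
theorem eLpNorm_diff_diff_conv_le {f g : EuclideanSpace ℝ (Fin n) → ℝ} (hf : Measurable f)
    (hg : Measurable g) {p₀ p₁ p : ℝ≥0∞} (hY : YoungTriple p₀ p₁ p)
    (hfp : eLpNorm f p₀ volume < ⊤) (hgp : eLpNorm g p₁ volume < ⊤)
    (h k : EuclideanSpace ℝ (Fin n)) :
    eLpNorm (diff h (diff k (conv f g))) p (strictMeasure n p) ≤
      eLpNorm (diff h f) p₀ volume * eLpNorm (diff k g) p₁ volume := by
  rw [eLpNorm_congr_ae (diff_congr p h (conv_diff_right hf hg hY hfp hgp k))]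
  exact eLpNorm_diff_conv_le hf (measurable_diff k hg) hY hfp
    (eLpNorm_diff_lt_top k hg hgp) h

/-! ### Sequence norms -/

/-- The `ℓ^p(ℤ)` norm of a sequence of nonnegative extended reals. -/
def ellNorm (p : ℝ≥0∞) (t : ℤ → ℝ≥0∞) : ℝ≥0∞ := eLpNorm t p Measure.count

theorem ellNorm_top (t : ℤ → ℝ≥0∞) : ellNorm ⊤ t = ⨆ m, t m := by
  simp [ellNorm]

theorem ellNorm_eq_tsum {p : ℝ≥0∞} (hp : 1 ≤ p) (hpt : p ≠ ⊤) (t : ℤ → ℝ≥0∞) :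
    ellNorm p t = (∑' m, t m ^ p.toReal) ^ (1 / p.toReal) := by
  rw [ellNorm, eLpNorm_eq_lintegral_rpow_enorm_toReal (zero_lt_one.trans_le hp).ne' hpt,
    lintegral_count]
  simp

theorem ellNorm_one (t : ℤ → ℝ≥0∞) : ellNorm 1 t = ∑' m, t m := by
  simp [ellNorm_eq_tsum le_rfl ENNReal.one_ne_top]

theorem ellNorm_rpow {p : ℝ≥0∞} (hp : 1 ≤ p) (hpt : p ≠ ⊤) (t : ℤ → ℝ≥0∞) :
    ellNorm p t ^ p.toReal = ∑' m, t m ^ p.toReal := by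
  have := one_le_toReal hp hpt
  rw [ellNorm_eq_tsum hp hpt, ← ENNReal.rpow_mul, one_div_mul_cancel (by linarith),
    ENNReal.rpow_one]

theorem le_ellNorm {p : ℝ≥0∞} (hp : 1 ≤ p) (t : ℤ → ℝ≥0∞) (m : ℤ) : t m ≤ ellNorm p t :=
  (enorm_eq_self (t m)).symm.trans_le (enorm_le_eLpNorm_count t m (zero_lt_one.trans_le hp).ne')

theorem ellNorm_mono {p : ℝ≥0∞} {s t : ℤ → ℝ≥0∞} (h : ∀ m, s m ≤ t m) :
    ellNorm p s ≤ ellNorm p t :=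
  eLpNorm_mono_enorm fun m => by simpa using h m

theorem ellNorm_mul_const_le {p : ℝ≥0∞} (hp : 1 ≤ p) (t : ℤ → ℝ≥0∞) (c : ℝ≥0∞) :
    ellNorm p (fun m => t m * c) ≤ ellNorm p t * c := by
  rcases eq_or_ne p ⊤ with rfl | hpt
  · rw [ellNorm_top, ellNorm_top, ENNReal.iSup_mul]
  · have h0 : 0 < p.toReal := zero_lt_one.trans_le (one_le_toReal hp hpt)
    rw [← ENNReal.rpow_le_rpow_iff h0, ENNReal.mul_rpow_of_nonneg _ _ h0.le,
      ellNorm_rpow hp hpt, ellNorm_rpow hp hpt, ← ENNReal.tsum_mul_right]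
    simp_rw [ENNReal.mul_rpow_of_nonneg _ _ h0.le]
    exact le_rfl

theorem ellNorm_le_of_le {p q : ℝ≥0∞} (hp : 1 ≤ p) (hpq : p ≤ q) (t : ℤ → ℝ≥0∞) :
    ellNorm q t ≤ ellNorm p t := by
  rcases eq_or_ne q ⊤ with rfl | hqt
  · rw [ellNorm_top]
    exact iSup_le (le_ellNorm hp t)
  · have hpt : p ≠ ⊤ := ne_top_of_le_ne_top hqt hpq
    have hq : 1 ≤ q := hp.trans hpq
    have hp0 : 0 < p.toReal := zero_lt_one.trans_le (one_le_toReal hp hpt)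
    have hq0 : 0 < q.toReal := zero_lt_one.trans_le (one_le_toReal hq hqt)
    have hpq' : 0 ≤ q.toReal - p.toReal := sub_nonneg.2 (ENNReal.toReal_mono hqt hpq)
    have hsplit (s : ℝ≥0∞) : s ^ q.toReal = s ^ p.toReal * s ^ (q.toReal - p.toReal) := by
      rw [← ENNReal.rpow_add_of_nonneg _ _ hp0.le hpq']
      congr 1
      ring
    rw [← ENNReal.rpow_le_rpow_iff hq0, ellNorm_rpow hq hqt, hsplit (ellNorm p t),
      ellNorm_rpow hp hpt, ← ENNReal.tsum_mul_right]
    refine ENNReal.tsum_le_tsum fun m => ?_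
    rw [hsplit]
    gcongr
    exact le_ellNorm hp t m

/-- Hölder's inequality, combined with the monotonicity of the `ℓ^p` norms in `p`. -/
theorem tsum_mul_le_ellNorm_mul_ellNorm {p₀ p₁ : ℝ≥0∞} (hp₀ : 1 ≤ p₀) (hp₁ : 1 ≤ p₁)
    (h : 1 ≤ p₀⁻¹ + p₁⁻¹) (s t : ℤ → ℝ≥0∞) :
    ∑' m, s m * t m ≤ ellNorm p₀ s * ellNorm p₁ t := by
  have h₀ : p₀⁻¹ ≤ 1 := ENNReal.inv_le_one.2 hp₀
  set q : ℝ≥0∞ := (1 - p₀⁻¹)⁻¹ with hq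
  have hq1 : 1 ≤ q := ENNReal.one_le_inv.2 tsub_le_self
  have hpq : p₁ ≤ q := by
    rw [hq, ENNReal.le_inv_iff_le_inv]
    exact tsub_le_iff_left.2 h
  refine le_trans ?_ (mul_le_mul_right (ellNorm_le_of_le hp₁ hpq t) _)
  rcases eq_or_ne p₀ ⊤ with rfl | hp₀t
  · have : q = 1 := by simp [hq]
    rw [this, ellNorm_one, ← ENNReal.tsum_mul_left]
    exact ENNReal.tsum_le_tsum fun m => by gcongr; exact le_ellNorm hp₀ s m
  rcases eq_or_ne p₀ 1 with rfl | hp₀1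
  · rw [ellNorm_one, ← ENNReal.tsum_mul_right]
    exact ENNReal.tsum_le_tsum fun m => by gcongr; exact le_ellNorm hq1 t m
  have hlt : 1 < p₀ := lt_of_le_of_ne hp₀ (Ne.symm hp₀1)
  have hqt : q ≠ ⊤ := by
    rw [hq, ENNReal.inv_ne_top]
    exact (tsub_pos_of_lt (ENNReal.inv_lt_one.2 hlt)).ne'
  have hc : p₀.toReal.HolderConjugate q.toReal := by
    refine Real.holderConjugate_iff.2 ⟨?_, ?_⟩
    · simpa using (ENNReal.toReal_lt_toReal ENNReal.one_ne_top hp₀t).2 hlt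
    · rw [← ENNReal.toReal_inv, ← ENNReal.toReal_inv, hq, inv_inv,
        ENNReal.toReal_sub_of_le h₀ ENNReal.one_ne_top]
      simp
  have := ENNReal.lintegral_mul_le_Lp_mul_Lq (Measure.count : Measure ℤ) hc
    (f := s) (g := t) (measurable_from_top.aemeasurable) (measurable_from_top.aemeasurable)
  simp only [lintegral_count] at this
  rw [ellNorm_eq_tsum hp₀ hp₀t, ellNorm_eq_tsum hq1 hqt]
  exact this

/-! ### Dyadic characterization of the Slobodeckij seminorm -/

/-- The supremum of the difference quotients `|h|^{-σ} ‖u(· + h) - u‖_p` over the sphere `|h| = r`,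
the norm being that of `L^p(μ)`. -/
def modulus (μ : Measure (EuclideanSpace ℝ (Fin n))) (σ : ℝ) (p : ℝ≥0∞)
    (u : EuclideanSpace ℝ (Fin n) → ℝ) (r : ℝ) : ℝ≥0∞ :=
  ⨆ (h : EuclideanSpace ℝ (Fin n)) (_ : ‖h‖ = r), ‖h‖ₑ ^ (-σ) * eLpNorm (diff h u) p μ

/-- A dyadic form of the seminorm of order `σ`: the `ℓ^p` norm of the moduli at the radii `2^m r`,
uniformly in `r`. -/
def besov (μ : Measure (EuclideanSpace ℝ (Fin n))) (σ : ℝ) (p : ℝ≥0∞)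
    (u : EuclideanSpace ℝ (Fin n) → ℝ) : ℝ≥0∞ :=
  ⨆ (r : ℝ) (_ : 0 < r), ellNorm p fun m : ℤ => modulus μ σ p u (2 ^ m * r)

theorem le_modulus (μ : Measure (EuclideanSpace ℝ (Fin n))) (σ : ℝ) (p : ℝ≥0∞)
    (u : EuclideanSpace ℝ (Fin n) → ℝ) (h : EuclideanSpace ℝ (Fin n)) :
    ‖h‖ₑ ^ (-σ) * eLpNorm (diff h u) p μ ≤ modulus μ σ p u ‖h‖ :=
  le_iSup₂_of_le h rfl le_rfl

theorem ellNorm_modulus_le_besov (μ : Measure (EuclideanSpace ℝ (Fin n))) (σ : ℝ) (p : ℝ≥0∞)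
    (u : EuclideanSpace ℝ (Fin n) → ℝ) {r : ℝ} (hr : 0 < r) :
    ellNorm p (fun m : ℤ => modulus μ σ p u (2 ^ m * r)) ≤ besov μ σ p u :=
  le_iSup₂_of_le r hr le_rfl

theorem eLpNorm_diff_le_rpow_mul_modulus (μ : Measure (EuclideanSpace ℝ (Fin n))) (σ : ℝ)
    (p : ℝ≥0∞) (u : EuclideanSpace ℝ (Fin n) → ℝ) (h : EuclideanSpace ℝ (Fin n)) (hh : h ≠ 0) :
    eLpNorm (diff h u) p μ ≤ ‖h‖ₑ ^ σ * modulus μ σ p u ‖h‖ := by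
  have h0 : ‖h‖ₑ ≠ 0 := by simpa using hh
  calc eLpNorm (diff h u) p μ = ‖h‖ₑ ^ σ * (‖h‖ₑ ^ (-σ) * eLpNorm (diff h u) p μ) := by
        rw [← mul_assoc, ← ENNReal.rpow_add _ _ h0 enorm_ne_top]
        simp
    _ ≤ _ := by gcongr; exact le_modulus μ σ p u h

theorem eLpNorm_rpow_toReal {μ : Measure (EuclideanSpace ℝ (Fin n))} {p : ℝ≥0∞} (hp : 1 ≤ p)
    (hpt : p ≠ ⊤) (u : EuclideanSpace ℝ (Fin n) → ℝ) :
    eLpNorm u p μ ^ p.toReal = ∫⁻ x, ‖u x‖ₑ ^ p.toReal ∂μ := by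
  have := one_le_toReal hp hpt
  rw [eLpNorm_eq_lintegral_rpow_enorm_toReal (zero_lt_one.trans_le hp).ne' hpt,
    ← ENNReal.rpow_mul, one_div_mul_cancel (by linarith), ENNReal.rpow_one]

theorem measurable_eLpNorm_diff_rpow {p : ℝ≥0∞} (hp : 1 ≤ p) (hpt : p ≠ ⊤)
    {u : EuclideanSpace ℝ (Fin n) → ℝ} (hu : Measurable u) :
    Measurable fun h => eLpNorm (diff h u) p volume ^ p.toReal := by
  simp_rw [eLpNorm_rpow_toReal hp hpt]
  refine Measurable.lintegral_prod_right' (f := fun z : EuclideanSpace ℝ (Fin n) ×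
      EuclideanSpace ℝ (Fin n) => ‖u (z.2 + z.1) - u z.2‖ₑ ^ p.toReal) ?_
  exact ((hu.comp (measurable_snd.add measurable_fst)).sub
    (hu.comp measurable_snd)).enorm.pow_const _

/-- The integrand `‖u(· + h) - u‖_p^p / |h|^{n + σp}` of the Slobodeckij seminorm. -/
def gagliardoDensity (σ : ℝ) (p : ℝ≥0∞) (u : EuclideanSpace ℝ (Fin n) → ℝ)
    (h : EuclideanSpace ℝ (Fin n)) : ℝ≥0∞ :=
  eLpNorm (diff h u) p volume ^ p.toReal / ‖h‖ₑ ^ ((n : ℝ) + σ * p.toReal)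

theorem measurable_gagliardoDensity (σ : ℝ) {p : ℝ≥0∞} (hp : 1 ≤ p) (hpt : p ≠ ⊤)
    {u : EuclideanSpace ℝ (Fin n) → ℝ} (hu : Measurable u) :
    Measurable (gagliardoDensity σ p u) :=
  (measurable_eLpNorm_diff_rpow hp hpt hu).div (measurable_enorm.pow_const _)

theorem gagliardoSeminorm_eq_lintegral (σ : ℝ) {p : ℝ≥0∞} (hp : 1 ≤ p) (hpt : p ≠ ⊤)
    {u : EuclideanSpace ℝ (Fin n) → ℝ} (hu : Measurable u) :
    gagliardoSeminorm σ p u =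
      (ENNReal.ofReal (σ * (1 - σ)) * ∫⁻ h, gagliardoDensity σ p u h) ^ (1 / p.toReal) := by
  rw [gagliardoSeminorm, if_neg hpt]
  congr 2
  calc ∫⁻ x : EuclideanSpace ℝ (Fin n), ∫⁻ y : EuclideanSpace ℝ (Fin n),
        ‖u x - u y‖ₑ ^ p.toReal / ‖x - y‖ₑ ^ ((n : ℝ) + σ * p.toReal)
      = ∫⁻ x : EuclideanSpace ℝ (Fin n), ∫⁻ h : EuclideanSpace ℝ (Fin n),
        ‖u (x + h) - u x‖ₑ ^ p.toReal / ‖h‖ₑ ^ ((n : ℝ) + σ * p.toReal) := by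
        refine lintegral_congr fun x => ?_
        rw [← lintegral_add_left_eq_self _ x]
        refine lintegral_congr fun h => ?_
        rw [enorm_sub_rev (u x), enorm_sub_rev x, add_sub_cancel_left]
    _ = ∫⁻ h : EuclideanSpace ℝ (Fin n), ∫⁻ x : EuclideanSpace ℝ (Fin n),
        ‖u (x + h) - u x‖ₑ ^ p.toReal / ‖h‖ₑ ^ ((n : ℝ) + σ * p.toReal) := by
        refine lintegral_lintegral_swap ?_
        exact ((((hu.comp (measurable_fst.add measurable_snd)).sub
          (hu.comp measurable_fst)).enorm.pow_const _).div
          (measurable_snd.enorm.pow_const _)).aemeasurable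
    _ = ∫⁻ h, gagliardoDensity σ p u h := by
        refine lintegral_congr fun h => ?_
        simp only [div_eq_mul_inv, gagliardoDensity]
        rw [lintegral_mul_const, eLpNorm_rpow_toReal hp hpt]
        · rfl
        · exact ((hu.comp (measurable_add_const h)).sub hu).enorm.pow_const _

theorem gagliardoSeminorm_congr (σ : ℝ) {p : ℝ≥0∞} (hpt : p ≠ ⊤)
    {u v : EuclideanSpace ℝ (Fin n) → ℝ} (huv : u =ᵐ[volume] v) :
    gagliardoSeminorm σ p u = gagliardoSeminorm σ p v := by
  rw [gagliardoSeminorm, gagliardoSeminorm, if_neg hpt, if_neg hpt]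
  congr 2
  refine lintegral_congr_ae ?_
  filter_upwards [huv] with x hx
  refine lintegral_congr_ae ?_
  filter_upwards [huv] with y hy
  rw [hx, hy]

/-- Subadditivity of `h ↦ ‖Δ_h u‖_p`. -/
theorem eLpNorm_diff_sub_le {p : ℝ≥0∞} (hp : 1 ≤ p) {u : EuclideanSpace ℝ (Fin n) → ℝ}
    (hu : Measurable u) (h k : EuclideanSpace ℝ (Fin n)) :
    eLpNorm (diff h u) p volume ≤
      eLpNorm (diff k u) p volume + eLpNorm (diff (h - k) u) p volume := by
  have h1 : diff h u = diff k u + fun x => diff (h - k) u (x + k) := by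
    ext x
    simp only [diff, Pi.add_apply]
    rw [show x + k + (h - k) = x + h by abel]
    ring
  have h2 : eLpNorm (fun x => diff (h - k) u (x + k)) p volume =
      eLpNorm (diff (h - k) u) p volume :=
    eLpNorm_comp_measurePreserving (f := fun x => x + k) (g := diff (h - k) u)
      (measurable_diff (h - k) hu).aestronglyMeasurable (measurePreserving_add_right volume k)
  rw [h1, ← h2]
  exact eLpNorm_add_le (measurable_diff k hu).aestronglyMeasurable
    ((measurable_diff (h - k) hu).comp (measurable_add_const k)).aestronglyMeasurable hp

/-- The dyadic shell on which the differences are averaged in order to bound those of step `r`. -/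
def shell (n : ℕ) (r : ℝ) : Set (EuclideanSpace ℝ (Fin n)) :=
  {k | 3 / 8 * r ≤ ‖k‖ ∧ ‖k‖ < 2 * (3 / 8 * r)}

theorem measurableSet_shell (r : ℝ) : MeasurableSet (shell n r) :=
  (measurableSet_le measurable_const measurable_norm).inter
    (measurableSet_lt measurable_norm measurable_const)

theorem pairwise_disjoint_shell {r : ℝ} (hr : 0 < r) :
    Pairwise (Function.onFun Disjoint fun m : ℤ => shell n (2 ^ m * r)) := by
  have key (a b : ℤ) (hab : a < b) : Disjoint (shell n (2 ^ a * r)) (shell n (2 ^ b * r)) := by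
    refine Set.disjoint_left.2 fun k hk hk' => ?_
    have h1 : (2 : ℝ) ^ (a + 1) ≤ 2 ^ b := zpow_le_zpow_right₀ (by norm_num) (by omega)
    rw [zpow_add_one₀ (by norm_num)] at h1
    have h2 := hk.2
    have h3 := hk'.1
    nlinarith
  intro a b hab
  rcases lt_or_gt_of_ne hab with h | h
  · exact key a b h
  · exact (key b a h).symm

/-- The ball of radius `|h| / 8` about `h / 2` consists of increments `k` with
`3|h|/8 ≤ |k| < 3|h|/4`, and it is invariant under `k ↦ h - k`. -/
theorem ball_subset_shell {h k : EuclideanSpace ℝ (Fin n)} (hh : h ≠ 0)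
    (hk : k ∈ Metric.ball ((1 / 2 : ℝ) • h) (‖h‖ / 8)) : k ∈ shell n ‖h‖ := by
  have hpos : 0 < ‖h‖ := norm_pos_iff.2 hh
  rw [mem_ball_iff_norm] at hk
  have h1 : ‖(1 / 2 : ℝ) • h‖ = ‖h‖ / 2 := by rw [norm_smul]; norm_num; ring
  have h2 := norm_sub_norm_le ((1 / 2 : ℝ) • h) k
  have h3 := norm_sub_norm_le k ((1 / 2 : ℝ) • h)
  rw [norm_sub_rev] at h2
  constructor <;> linarith

/-- Averaging `‖Δ_h u‖_p ≤ ‖Δ_k u‖_p + ‖Δ_{h-k} u‖_p` over the increments `k` in a ball about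
`h / 2` that is invariant under `k ↦ h - k`. -/
theorem volume_ball_mul_eLpNorm_diff_rpow_le {p : ℝ≥0∞} (hp : 1 ≤ p) (hpt : p ≠ ⊤)
    {u : EuclideanSpace ℝ (Fin n) → ℝ} (hu : Measurable u) {h : EuclideanSpace ℝ (Fin n)}
    (hh : h ≠ 0) :
    volume (Metric.ball ((1 / 2 : ℝ) • h) (‖h‖ / 8)) * eLpNorm (diff h u) p volume ^ p.toReal ≤
      2 ^ p.toReal * ∫⁻ k in shell n ‖h‖, eLpNorm (diff k u) p volume ^ p.toReal := by
  set B := Metric.ball ((1 / 2 : ℝ) • h) (‖h‖ / 8)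
  set φ := fun k => eLpNorm (diff k u) p volume ^ p.toReal with hφ
  have hm : Measurable φ := measurable_eLpNorm_diff_rpow hp hpt hu
  have hrefl : ∫⁻ k in B, φ (h - k) = ∫⁻ k in B, φ k := by
    have hB : (fun k => h - k) ⁻¹' B = B := by
      ext k
      simp only [B, mem_preimage, mem_ball_iff_norm]
      rw [show h - k - (1 / 2 : ℝ) • h = -(k - (1 / 2 : ℝ) • h) by
        rw [neg_sub, sub_right_comm]
        congr 1
        nth_rewrite 1 [← one_smul ℝ h]
        rw [← sub_smul]
        norm_num, norm_neg]
    have := (volume.measurePreserving_sub_left h).setLIntegral_comp_preimage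
      (s := B) Metric.isOpen_ball.measurableSet hm
    rwa [hB] at this
  have hp1 := one_le_toReal hp hpt
  calc volume B * φ h = ∫⁻ _ in B, φ h := by rw [setLIntegral_const, mul_comm]
    _ ≤ ∫⁻ k in B, 2 ^ (p.toReal - 1) * (φ k + φ (h - k)) := by
        refine lintegral_mono fun k => ?_
        exact (ENNReal.rpow_le_rpow (eLpNorm_diff_sub_le hp hu h k) (by linarith)).trans
          (ENNReal.rpow_add_le_mul_rpow_add_rpow _ _ hp1)
    _ = 2 ^ (p.toReal - 1) * ((∫⁻ k in B, φ k) + ∫⁻ k in B, φ k) := by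
        have hm' : Measurable fun k => φ k + φ (h - k) :=
          hm.add (hm.comp (measurable_const.sub measurable_id))
        rw [lintegral_const_mul _ hm', lintegral_add_left hm, hrefl]
    _ = 2 ^ p.toReal * ∫⁻ k in B, φ k := by
        rw [← two_mul, ← mul_assoc]
        congr 1
        nth_rewrite 2 [← ENNReal.rpow_one 2]
        rw [← ENNReal.rpow_add _ _ (by norm_num) (by norm_num)]
        congr 1
        ring
    _ ≤ _ := by
        gcongr
        exact fun k hk => ball_subset_shell hh hk

/-- The supremum over the sphere `|h| = r` is bounded by an integral over a dyadic shell: this is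
the step from the Slobodeckij seminorm to the supremum in the dyadic seminorm. The shells for the
radii `2^m r` are disjoint, so that these bounds can be added. -/
theorem exists_modulus_rpow_le (n : ℕ) (σ : ℝ) (hσ : 0 < σ) {p : ℝ≥0∞} (hp : 1 ≤ p)
    (hpt : p ≠ ⊤) : ∃ C : ℝ≥0∞, C ≠ ⊤ ∧ ∀ u : EuclideanSpace ℝ (Fin n) → ℝ, Measurable u →
      ∀ r : ℝ, 0 < r → modulus volume σ p u r ^ p.toReal ≤
        C * ∫⁻ k in shell n r, gagliardoDensity σ p u k := by
  have hp1 := one_le_toReal hp hpt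
  have hp0 : 0 < p.toReal := by linarith
  set e : ℝ := (n : ℝ) + σ * p.toReal with he
  have he0 : 0 ≤ e := by positivity
  set c : ℝ≥0∞ := ENNReal.ofReal ((1 / 8) ^ n) *
    volume (Metric.ball (0 : EuclideanSpace ℝ (Fin n)) 1) with hc
  have hc0 : c ≠ 0 := by
    refine mul_ne_zero (by simp) (Metric.measure_ball_pos _ _ one_pos).ne'
  have hct : c ≠ ⊤ := ENNReal.mul_ne_top ENNReal.ofReal_ne_top measure_ball_lt_top.ne
  refine ⟨c⁻¹ * 2 ^ p.toReal, ENNReal.mul_ne_top (ENNReal.inv_ne_top.2 hc0)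
    (ENNReal.rpow_ne_top_of_nonneg hp0.le (by norm_num)), fun u hu r hr => ?_⟩
  set I := ∫⁻ k in shell n r, gagliardoDensity σ p u k with hI
  suffices H : ∀ h : EuclideanSpace ℝ (Fin n), ‖h‖ = r →
      (‖h‖ₑ ^ (-σ) * eLpNorm (diff h u) p volume) ^ p.toReal ≤ c⁻¹ * 2 ^ p.toReal * I by
    rw [← ENNReal.le_rpow_inv_iff hp0]
    exact iSup₂_le fun h hh => (ENNReal.le_rpow_inv_iff hp0).2 (H h hh)
  intro h hhr
  have hh : h ≠ 0 := by
    rintro rfl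
    simp at hhr
    linarith
  have hz : ‖h‖ₑ ≠ 0 := by simpa using hh
  have hzt : ‖h‖ₑ ≠ ⊤ := enorm_ne_top
  have hvol : volume (Metric.ball ((1 / 2 : ℝ) • h) (‖h‖ / 8)) = ‖h‖ₑ ^ (n : ℝ) * c := by
    rw [Measure.addHaar_ball_of_pos _ _ (by positivity), finrank_euclideanSpace_fin, hc,
      ← mul_assoc,
      div_eq_mul_one_div, mul_pow, ENNReal.ofReal_mul (by positivity),
      ENNReal.ofReal_pow (norm_nonneg _), ofReal_norm, ENNReal.rpow_natCast]
  have h1 := volume_ball_mul_eLpNorm_diff_rpow_le hp hpt hu hh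
  rw [hvol, hhr] at h1
  have h2 : ∫⁻ k in shell n r, eLpNorm (diff k u) p volume ^ p.toReal ≤ ‖h‖ₑ ^ e * I := by
    rw [hI, ← lintegral_const_mul _ (measurable_gagliardoDensity σ hp hpt hu)]
    refine setLIntegral_mono' (measurableSet_shell r) fun k hk => ?_
    have hk0 : ‖k‖ₑ ≠ 0 := by
      have : 0 < ‖k‖ := lt_of_lt_of_le (by positivity) hk.1
      simpa using norm_pos_iff.1 this
    have hkr : ‖k‖ₑ ≤ ‖h‖ₑ := by
      rw [← ofReal_norm, ← ofReal_norm, hhr]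
      refine ENNReal.ofReal_le_ofReal ?_
      have := hk.2
      linarith
    calc eLpNorm (diff k u) p volume ^ p.toReal = ‖k‖ₑ ^ e * gagliardoDensity σ p u k := by
          rw [gagliardoDensity, ENNReal.mul_div_cancel]
          · intro h0
            rcases ENNReal.rpow_eq_zero_iff.1 h0 with ⟨h, -⟩ | ⟨-, h⟩
            · exact hk0 h
            · exact he0.not_gt h
          · exact ENNReal.rpow_ne_top_of_nonneg he0 enorm_ne_top
      _ ≤ _ := by gcongr
  have h3 : ‖h‖ₑ ^ (n : ℝ) * c * eLpNorm (diff h u) p volume ^ p.toReal ≤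
      2 ^ p.toReal * (‖h‖ₑ ^ e * I) := h1.trans (by gcongr)
  calc (‖h‖ₑ ^ (-σ) * eLpNorm (diff h u) p volume) ^ p.toReal
      = c⁻¹ * ‖h‖ₑ ^ (-e) *
        (‖h‖ₑ ^ (n : ℝ) * c * eLpNorm (diff h u) p volume ^ p.toReal) := by
        rw [ENNReal.mul_rpow_of_nonneg _ _ hp0.le, ← ENNReal.rpow_mul]
        calc _ = (c⁻¹ * c) * (‖h‖ₑ ^ (-e) * ‖h‖ₑ ^ (n : ℝ)) *
              eLpNorm (diff h u) p volume ^ p.toReal := by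
              rw [ENNReal.inv_mul_cancel hc0 hct, one_mul, ← ENNReal.rpow_add _ _ hz hzt, he]
              congr 2
              ring
          _ = _ := by ring
    _ ≤ c⁻¹ * ‖h‖ₑ ^ (-e) * (2 ^ p.toReal * (‖h‖ₑ ^ e * I)) := by gcongr
    _ = c⁻¹ * 2 ^ p.toReal * I * (‖h‖ₑ ^ (-e) * ‖h‖ₑ ^ e) := by ring
    _ = c⁻¹ * 2 ^ p.toReal * I := by
        rw [← ENNReal.rpow_add _ _ hz hzt]
        simp

theorem besov_top_le_gagliardoSeminorm {σ : ℝ} (hσ : 0 < σ) (u : EuclideanSpace ℝ (Fin n) → ℝ) :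
    besov volume σ ⊤ u ≤ gagliardoSeminorm σ ⊤ u := by
  refine iSup₂_le fun r hr => ?_
  rw [ellNorm_top]
  refine iSup_le fun m => iSup₂_le fun h hh => ?_
  have h0 : h ≠ 0 := by
    rintro rfl
    rw [norm_zero] at hh
    have : (0 : ℝ) < 2 ^ m * r := by positivity
    linarith
  have hz' : ‖h‖ₑ ^ σ ≠ 0 := by
    simpa [hσ, hσ.not_gt] using h0
  have hzt' : ‖h‖ₑ ^ σ ≠ ⊤ := ENNReal.rpow_ne_top_of_nonneg hσ.le enorm_ne_top
  rw [ENNReal.rpow_neg, mul_comm, ← div_eq_mul_inv]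
  refine ENNReal.div_le_of_le_mul ?_
  rw [eLpNorm_exponent_top]
  refine essSup_le_of_ae_le _ (Eventually.of_forall fun x => ?_)
  have key : ‖u (x + h) - u x‖ₑ / ‖x + h - x‖ₑ ^ σ ≤ gagliardoSeminorm σ ⊤ u := by
    rw [gagliardoSeminorm, if_pos rfl]
    exact le_iSup_of_le (x + h) (le_iSup_of_le x (le_iSup_of_le (by simpa using h0) le_rfl))
  rw [add_sub_cancel_left] at key
  rwa [ENNReal.div_le_iff hz' hzt'] at key

/-- The Slobodeckij seminorm controls its dyadic form. Lebesgue measure suffices here, as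
convolutions do not depend on the representatives of the factors. -/
theorem exists_besov_le_gagliardoSeminorm (n : ℕ) {σ : ℝ} (hσ : 0 < σ) (hσ1 : σ < 1) {p : ℝ≥0∞}
    (hp : 1 ≤ p) : ∃ C : ℝ≥0∞, C ≠ ⊤ ∧ ∀ u : EuclideanSpace ℝ (Fin n) → ℝ, Measurable u →
      besov volume σ p u ≤ C * gagliardoSeminorm σ p u := by
  rcases eq_or_ne p ⊤ with rfl | hpt
  · refine ⟨1, ENNReal.one_ne_top, fun u hu => ?_⟩
    rw [one_mul]
    exact besov_top_le_gagliardoSeminorm hσ u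
  · obtain ⟨C, hC, H⟩ := exists_modulus_rpow_le n σ hσ hp hpt
    have hp1 := one_le_toReal hp hpt
    have hp0 : 0 < p.toReal := by linarith
    have hs : 0 < σ * (1 - σ) := mul_pos hσ (by linarith)
    refine ⟨(C / ENNReal.ofReal (σ * (1 - σ))) ^ (1 / p.toReal),
      ENNReal.rpow_ne_top_of_nonneg (by positivity) (ENNReal.div_ne_top hC (by simpa using hs)),
      fun u hu => ?_⟩
    rw [gagliardoSeminorm_eq_lintegral σ hp hpt hu,
      ← ENNReal.mul_rpow_of_nonneg _ _ (by positivity), ← mul_assoc,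
      ENNReal.div_mul_cancel (by simpa using hs) ENNReal.ofReal_ne_top]
    refine iSup₂_le fun r hr => ?_
    rw [ellNorm_eq_tsum hp hpt]
    refine ENNReal.rpow_le_rpow ?_ (by positivity)
    calc ∑' m : ℤ, modulus volume σ p u (2 ^ m * r) ^ p.toReal
        ≤ ∑' m : ℤ, C * ∫⁻ k in shell n (2 ^ m * r), gagliardoDensity σ p u k :=
          ENNReal.tsum_le_tsum fun m => H u hu _ (by positivity)
      _ = C * ∫⁻ k in ⋃ m : ℤ, shell n (2 ^ m * r), gagliardoDensity σ p u k := by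
          rw [ENNReal.tsum_mul_left, lintegral_iUnion (fun m => measurableSet_shell _)
            (pairwise_disjoint_shell hr)]
      _ ≤ C * ∫⁻ k, gagliardoDensity σ p u k := by
          gcongr
          exact Measure.restrict_le_self

/-- The dyadic seminorm taken with Lebesgue measure does not change if `v` is modified on a null
set, hence it is also controlled by the infimum over all representatives. -/
theorem exists_besov_le_derivGagliardoSeminorm (n : ℕ) {σ : ℝ} (hσ : 0 < σ) (hσ1 : σ < 1)
    {p : ℝ≥0∞} (hp : 1 ≤ p) : ∃ C : ℝ≥0∞, C ≠ ⊤ ∧ ∀ (α : Fin n → ℕ)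
      (u v : EuclideanSpace ℝ (Fin n) → ℝ), IsWeakDeriv α u v →
      besov volume σ p v ≤ C * derivGagliardoSeminorm α σ p u := by
  obtain ⟨C, hC, H⟩ := exists_besov_le_gagliardoSeminorm n hσ hσ1 hp
  have hcongr {v w : EuclideanSpace ℝ (Fin n) → ℝ} (h : v =ᵐ[volume] w) :
      besov volume σ p v = besov volume σ p w := by
    have (k : EuclideanSpace ℝ (Fin n)) : eLpNorm (diff k v) p volume =
        eLpNorm (diff k w) p volume := by
      refine eLpNorm_congr_ae ?_
      filter_upwards [h, (measurePreserving_add_right volume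
        k).quasiMeasurePreserving.ae_eq_comp h] with x h1 h2
      simp only [Function.comp_apply] at h2
      simp only [diff, h1, h2]
    simp only [besov, modulus, this]
  have hbound {v : EuclideanSpace ℝ (Fin n) → ℝ} (hv : LocallyIntegrable v volume) :
      besov volume σ p v ≤ (C + 1) * gagliardoSeminorm σ p v := by
    have hm := hv.aestronglyMeasurable
    set w := hm.mk v
    have hvw : v =ᵐ[volume] w := hm.ae_eq_mk
    rcases eq_or_ne p ⊤ with rfl | hpt
    · refine le_trans ?_ (mul_le_mul_left (le_add_self : 1 ≤ C + 1) _)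
      rw [one_mul]
      exact besov_top_le_gagliardoSeminorm hσ v
    · rw [hcongr hvw, gagliardoSeminorm_congr σ hpt hvw]
      exact (H w hm.stronglyMeasurable_mk.measurable).trans (mul_le_mul_left le_self_add _)
  have hC1 : C + 1 ≠ ⊤ := by simp [hC]
  refine ⟨C + 1, hC1, fun α u v huv => ?_⟩
  rw [← ENNReal.div_le_iff' (by simp) hC1]
  refine le_iInf₂ fun w hw => ?_
  rw [ENNReal.div_le_iff' (by simp) hC1, hcongr (huv.ae_eq hw)]
  exact hbound hw.locallyIntegrable_right

theorem lintegral_comp_smul {Φ : EuclideanSpace ℝ (Fin n) → ℝ≥0∞} (hΦ : Measurable Φ) {c : ℝ}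
    (hc : 0 < c) : ∫⁻ h, Φ (c • h) = ENNReal.ofReal (c ^ n)⁻¹ * ∫⁻ h, Φ h := by
  rw [← lintegral_map hΦ (measurable_const_smul c), Measure.map_addHaar_smul _ hc.ne',
    lintegral_smul_measure, finrank_euclideanSpace_fin, abs_of_pos (by positivity), smul_eq_mul]

/-- The dyadic annulus `1 ≤ |h| < 2`. -/
def annulus (n : ℕ) : Set (EuclideanSpace ℝ (Fin n)) := {h | 1 ≤ ‖h‖ ∧ ‖h‖ < 2}

theorem measurableSet_annulus : MeasurableSet (annulus n) :=
  (measurableSet_le measurable_const measurable_norm).inter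
    (measurableSet_lt measurable_norm measurable_const)

/-- The dyadic form controls the Slobodeckij seminorm. For `p = ∞` the dyadic form has to be taken
with `strictMeasure`, since the Hölder seminorm is a supremum over all pairs of points. -/
theorem exists_gagliardoSeminorm_le_besov (n : ℕ) (σ : ℝ) {p : ℝ≥0∞}
    (hp : 1 ≤ p) : ∃ C : ℝ≥0∞, C ≠ ⊤ ∧ ∀ u : EuclideanSpace ℝ (Fin n) → ℝ, Measurable u →
      gagliardoSeminorm σ p u ≤ C * besov (strictMeasure n p) σ p u := by
  rcases eq_or_ne p ⊤ with rfl | hpt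
  · refine ⟨1, ENNReal.one_ne_top, fun u hu => ?_⟩
    rw [one_mul, gagliardoSeminorm, if_pos rfl]
    refine iSup_le fun x => iSup_le fun y => iSup_le fun hxy => ?_
    have h0 : x - y ≠ 0 := sub_ne_zero.2 hxy
    have h1 : ‖u x - u y‖ₑ ≤ eLpNorm (diff (x - y) u) ⊤ (strictMeasure n ⊤) := by
      rw [strictMeasure_top, eLpNorm_exponent_top, eLpNormEssSup_count]
      refine le_iSup_of_le y ?_
      simp [diff]
    have h2 := eLpNorm_diff_le_rpow_mul_modulus (strictMeasure n ⊤) σ ⊤ u (x - y) h0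
    refine ENNReal.div_le_of_le_mul' ((h1.trans h2).trans ?_)
    gcongr
    have h3 := ellNorm_modulus_le_besov (strictMeasure n ⊤) σ ⊤ u (norm_pos_iff.2 h0)
    refine le_trans ?_ ((le_ellNorm le_top _ 0).trans h3)
    simp
  · have hp1 := one_le_toReal hp hpt
    have hp0 : 0 < p.toReal := by linarith
    set e : ℝ := (n : ℝ) + σ * p.toReal with he
    refine ⟨(ENNReal.ofReal (σ * (1 - σ)) * volume (annulus n)) ^ (1 / p.toReal),
      ENNReal.rpow_ne_top_of_nonneg (by positivity) (ENNReal.mul_ne_top ENNReal.ofReal_ne_top ?_),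
      fun u hu => ?_⟩
    · refine (lt_of_le_of_lt (measure_mono ?_) (measure_ball_lt_top (μ := volume)
        (x := (0 : EuclideanSpace ℝ (Fin n))) (r := 2))).ne
      intro h hh
      simpa using hh.2
    rw [gagliardoSeminorm_eq_lintegral σ hp hpt hu, strictMeasure_of_ne_top hpt,
      ← ENNReal.rpow_le_rpow_iff hp0, ENNReal.mul_rpow_of_nonneg _ _ hp0.le, ← ENNReal.rpow_mul,
      ← ENNReal.rpow_mul, one_div_mul_cancel hp0.ne', ENNReal.rpow_one, ENNReal.rpow_one, mul_assoc]
    gcongr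
    have hm := measurable_gagliardoDensity σ hp hpt hu
    have hzero : gagliardoDensity σ p u 0 = 0 := by
      have : diff (0 : EuclideanSpace ℝ (Fin n)) u = 0 := by
        ext x
        simp [diff]
      simp [gagliardoDensity, this, hp0]
    -- every `h ≠ 0` lies in exactly one of the annuli `2 ^ m ≤ |h| < 2 ^ (m + 1)`
    have hpart (h : EuclideanSpace ℝ (Fin n)) : gagliardoDensity σ p u h ≤
        ∑' m : ℤ, (annulus n).indicator (fun k => gagliardoDensity σ p u ((2 : ℝ) ^ m • k))
          (((2 : ℝ) ^ m)⁻¹ • h) := by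
      rcases eq_or_ne h 0 with rfl | hh
      · simp [hzero]
      obtain ⟨m, hm1, hm2⟩ := exists_mem_Ico_zpow (norm_pos_iff.2 hh) (one_lt_two : (1 : ℝ) < 2)
      refine le_trans ?_ (ENNReal.le_tsum m)
      have h2m : (0 : ℝ) < 2 ^ m := by positivity
      rw [indicator_of_mem, smul_smul, mul_inv_cancel₀ h2m.ne', one_smul]
      rw [zpow_add_one₀ two_ne_zero] at hm2
      simp only [annulus, mem_ofPred_eq, norm_smul, norm_inv, Real.norm_eq_abs, abs_of_pos h2m]
      constructor
      · rw [inv_mul_eq_div, one_le_div h2m]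
        exact hm1
      · rw [inv_mul_eq_div, div_lt_iff₀ h2m, mul_comm]
        exact hm2
    have hscale (m : ℤ) (k : EuclideanSpace ℝ (Fin n)) (hk : k ∈ annulus n) :
        ENNReal.ofReal (((2 : ℝ) ^ m) ^ n) * gagliardoDensity σ p u ((2 : ℝ) ^ m • k) ≤
          modulus volume σ p u (2 ^ m * ‖k‖) ^ p.toReal := by
      have h2m : (0 : ℝ) < 2 ^ m := by positivity
      have hk0 : 0 < ‖k‖ := one_pos.trans_le hk.1
      set h := (2 : ℝ) ^ m • k with hh
      have hnorm : ‖h‖ = 2 ^ m * ‖k‖ := by rw [hh, norm_smul, Real.norm_eq_abs, abs_of_pos h2m]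
      have hz : ‖h‖ₑ ≠ 0 := by
        have : 0 < ‖h‖ := by rw [hnorm]; positivity
        simpa using norm_pos_iff.1 this
      have hzt : ‖h‖ₑ ≠ ⊤ := enorm_ne_top
      rw [← hnorm]
      calc ENNReal.ofReal (((2 : ℝ) ^ m) ^ n) * gagliardoDensity σ p u h
          ≤ ‖h‖ₑ ^ (n : ℝ) * gagliardoDensity σ p u h := by
            gcongr
            rw [ENNReal.rpow_natCast, ← ofReal_norm, ← ENNReal.ofReal_pow (norm_nonneg _)]
            refine ENNReal.ofReal_le_ofReal (pow_le_pow_left₀ h2m.le ?_ _)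
            rw [hnorm]
            exact le_mul_of_one_le_right h2m.le hk.1
        _ = (‖h‖ₑ ^ (-σ) * eLpNorm (diff h u) p volume) ^ p.toReal := by
            rw [gagliardoDensity, ENNReal.mul_rpow_of_nonneg _ _ hp0.le, ← ENNReal.rpow_mul,
              div_eq_mul_inv, ← ENNReal.rpow_neg, mul_left_comm,
              ← ENNReal.rpow_add _ _ hz hzt, mul_comm]
            congr 2
            ring
        _ ≤ _ := by
            gcongr
            exact le_modulus _ _ _ _ _
    calc ∫⁻ h, gagliardoDensity σ p u h
        ≤ ∫⁻ h, ∑' m : ℤ, (annulus n).indicator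
            (fun k => gagliardoDensity σ p u ((2 : ℝ) ^ m • k)) (((2 : ℝ) ^ m)⁻¹ • h) :=
          lintegral_mono hpart
      _ = ∑' m : ℤ, ∫⁻ h, (annulus n).indicator
            (fun k => gagliardoDensity σ p u ((2 : ℝ) ^ m • k)) (((2 : ℝ) ^ m)⁻¹ • h) := by
          refine lintegral_tsum fun m => Measurable.aemeasurable ?_
          exact ((hm.comp (measurable_const_smul _)).indicator measurableSet_annulus).comp
            (measurable_const_smul _)
      _ = ∑' m : ℤ, ∫⁻ k in annulus n, ENNReal.ofReal (((2 : ℝ) ^ m) ^ n) *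
            gagliardoDensity σ p u ((2 : ℝ) ^ m • k) := by
          refine tsum_congr fun m => ?_
          have h2m : (0 : ℝ) < 2 ^ m := by positivity
          have hm' : Measurable fun k => gagliardoDensity σ p u ((2 : ℝ) ^ m • k) :=
            hm.comp (measurable_const_smul _)
          rw [lintegral_comp_smul (hm'.indicator measurableSet_annulus) (inv_pos.2 h2m),
            lintegral_indicator measurableSet_annulus, lintegral_const_mul _ hm', inv_pow, inv_inv]
      _ = ∫⁻ k in annulus n, ∑' m : ℤ, ENNReal.ofReal (((2 : ℝ) ^ m) ^ n) *
            gagliardoDensity σ p u ((2 : ℝ) ^ m • k) := by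
          refine (lintegral_tsum fun m => Measurable.aemeasurable ?_).symm
          exact (hm.comp (measurable_const_smul _)).const_mul _
      _ ≤ ∫⁻ k in annulus n, besov volume σ p u ^ p.toReal := by
          refine setLIntegral_mono' measurableSet_annulus fun k hk => ?_
          refine (ENNReal.tsum_le_tsum fun m => hscale m k hk).trans ?_
          rw [← ellNorm_rpow hp hpt (fun m : ℤ => modulus volume σ p u (2 ^ m * ‖k‖))]
          gcongr
          exact ellNorm_modulus_le_besov _ _ _ _ (one_pos.trans_le hk.1)
      _ = volume (annulus n) * besov volume σ p u ^ p.toReal := by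
          rw [setLIntegral_const, mul_comm]

/-! ### Seminorms of convolutions, total order below one -/

theorem enorm_two_zpow (m : ℤ) : ‖(2 : ℝ) ^ m‖ₑ = (2 : ℝ≥0∞) ^ (m : ℝ) := by
  rw [← ofReal_norm, Real.norm_eq_abs, abs_of_pos (by positivity), ← Real.rpow_intCast,
    ← ENNReal.ofReal_rpow_of_pos two_pos]
  simp

theorem enorm_two_zpow_smul (m : ℤ) (h : EuclideanSpace ℝ (Fin n)) :
    ‖(2 : ℝ) ^ m • h‖ₑ = (2 : ℝ≥0∞) ^ (m : ℝ) * ‖h‖ₑ := by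
  rw [enorm_smul, enorm_two_zpow]

theorem norm_two_zpow_smul (m : ℤ) (h : EuclideanSpace ℝ (Fin n)) :
    ‖(2 : ℝ) ^ m • h‖ = 2 ^ m * ‖h‖ := by
  rw [norm_smul, Real.norm_eq_abs, abs_of_pos (by positivity)]

theorem two_rpow_add (a b : ℝ) : (2 : ℝ≥0∞) ^ (a + b) = 2 ^ a * 2 ^ b :=
  ENNReal.rpow_add _ _ two_ne_zero ENNReal.ofNat_ne_top

/-- If one factor carries all the smoothness, Young's inequality for `Δ_h (f * g) = (Δ_h f) * g`
suffices; the passage from `ℓ^{p₀}` to `ℓ^p` is possible because `p₀ ≤ p`. -/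
theorem besov_conv_le_mul_eLpNorm {f g : EuclideanSpace ℝ (Fin n) → ℝ} (hf : Measurable f)
    (hg : Measurable g) {p₀ p₁ p : ℝ≥0∞} (hY : YoungTriple p₀ p₁ p)
    (hfp : eLpNorm f p₀ volume < ⊤) (hgp : eLpNorm g p₁ volume < ⊤) (σ : ℝ) :
    besov (strictMeasure n p) σ p (conv f g) ≤ besov volume σ p₀ f * eLpNorm g p₁ volume := by
  refine iSup₂_le fun r hr => ?_
  calc ellNorm p (fun m : ℤ => modulus (strictMeasure n p) σ p (conv f g) (2 ^ m * r))
      ≤ ellNorm p (fun m : ℤ => modulus volume σ p₀ f (2 ^ m * r) * eLpNorm g p₁ volume) := by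
        refine ellNorm_mono fun m => iSup₂_le fun h hh => ?_
        rw [← hh]
        refine le_trans ?_ (mul_le_mul_left (le_modulus volume σ p₀ f h) _)
        rw [mul_assoc]
        gcongr
        exact eLpNorm_diff_conv_le hf hg hY hfp hgp h
    _ ≤ ellNorm p (fun m : ℤ => modulus volume σ p₀ f (2 ^ m * r)) * eLpNorm g p₁ volume :=
        ellNorm_mul_const_le hY.one_le _ _
    _ ≤ _ := by
        gcongr
        exact (ellNorm_le_of_le hY.one_le_left hY.left_le _).trans
          (ellNorm_modulus_le_besov _ _ _ _ hr)

theorem YoungTriple.one_le_inv_add_inv {p₀ p₁ p : ℝ≥0∞} (hY : YoungTriple p₀ p₁ p) :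
    1 ≤ p₀⁻¹ + p₁⁻¹ := hY.inv_add_one ▸ le_add_self

/-- The products of the moduli of `f` and `g` at dyadic radii are summable, because
`1/p₀ + 1/p₁ = 1 + 1/p ≥ 1`. Both radii may be scaled independently. -/
theorem tsum_modulus_mul_modulus_le {p₀ p₁ p : ℝ≥0∞} (hY : YoungTriple p₀ p₁ p) (σ₀ σ₁ : ℝ)
    (f g : EuclideanSpace ℝ (Fin n) → ℝ) {r s : ℝ} (hr : 0 < r) (hs : 0 < s) :
    ∑' m : ℤ, modulus volume σ₀ p₀ f (2 ^ m * r) * modulus volume σ₁ p₁ g (2 ^ m * s) ≤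
      besov volume σ₀ p₀ f * besov volume σ₁ p₁ g :=
  (tsum_mul_le_ellNorm_mul_ellNorm hY.one_le_left hY.one_le_right hY.one_le_inv_add_inv _ _).trans
    (mul_le_mul' (ellNorm_modulus_le_besov _ _ _ _ hr) (ellNorm_modulus_le_besov _ _ _ _ hs))

/-- Marchaud's inequality: first differences are bounded by second differences of larger steps,
because `Δ_h = (Δ_{2h} - Δ_h²) / 2`. -/
theorem eLpNorm_diff_le_tsum_diff_diff {p : ℝ≥0∞} (hp : 1 ≤ p)
    {u : EuclideanSpace ℝ (Fin n) → ℝ} (hu : Measurable u)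
    (hup : eLpNorm u p (strictMeasure n p) < ⊤) (h : EuclideanSpace ℝ (Fin n)) :
    eLpNorm (diff h u) p (strictMeasure n p) ≤ ∑' k : ℕ, 2⁻¹ ^ (k + 1) *
      eLpNorm (diff ((2 : ℝ) ^ (k : ℤ) • h) (diff ((2 : ℝ) ^ (k : ℤ) • h) u)) p
        (strictMeasure n p) := by
  set μ := strictMeasure n p
  have step (k : EuclideanSpace ℝ (Fin n)) : eLpNorm (diff k u) p μ ≤
      2⁻¹ * eLpNorm (diff k (diff k u)) p μ + 2⁻¹ * eLpNorm (diff ((2 : ℝ) • k) u) p μ := by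
    have h1 : diff k u = (2⁻¹ : ℝ) • (diff ((2 : ℝ) • k) u - diff k (diff k u)) := by
      ext x
      simp only [diff, Pi.smul_apply, Pi.sub_apply, smul_eq_mul, two_smul, ← add_assoc]
      ring
    have hh : ‖(2⁻¹ : ℝ)‖ₑ = 2⁻¹ := by
      rw [enorm_inv two_ne_zero, ← ofReal_norm]
      simp
    nth_rewrite 1 [h1]
    rw [eLpNorm_const_smul, hh, add_comm, ← mul_add]
    gcongr
    exact eLpNorm_sub_le (measurable_diff _ hu).aestronglyMeasurable
      (measurable_diff _ (measurable_diff _ hu)).aestronglyMeasurable hp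
  have hK (K : ℕ) : eLpNorm (diff h u) p μ ≤ (∑ k ∈ Finset.range K, 2⁻¹ ^ (k + 1) *
      eLpNorm (diff ((2 : ℝ) ^ (k : ℤ) • h) (diff ((2 : ℝ) ^ (k : ℤ) • h) u)) p μ) +
      2⁻¹ ^ K * eLpNorm (diff ((2 : ℝ) ^ (K : ℤ) • h) u) p μ := by
    induction K with
    | zero => simp
    | succ K ih =>
      refine ih.trans ?_
      rw [Finset.sum_range_succ, add_assoc]
      gcongr
      refine (mul_le_mul_right (step _) _).trans (le_of_eq ?_)
      rw [smul_smul, mul_add, ← mul_assoc, ← mul_assoc, ← pow_succ, Nat.cast_succ,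
        zpow_add_one₀ two_ne_zero, mul_comm (2 : ℝ)]
  have hlim : Tendsto (fun K : ℕ => (∑' k : ℕ, 2⁻¹ ^ (k + 1) *
      eLpNorm (diff ((2 : ℝ) ^ (k : ℤ) • h) (diff ((2 : ℝ) ^ (k : ℤ) • h) u)) p μ) +
      (2⁻¹ : ℝ≥0∞) ^ K * (2 * eLpNorm u p μ)) atTop (𝓝 ((∑' k : ℕ, 2⁻¹ ^ (k + 1) *
      eLpNorm (diff ((2 : ℝ) ^ (k : ℤ) • h) (diff ((2 : ℝ) ^ (k : ℤ) • h) u)) p μ) +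
      0 * (2 * eLpNorm u p μ))) := by
    refine tendsto_const_nhds.add (ENNReal.Tendsto.mul_const ?_
      (Or.inr (ENNReal.mul_ne_top ENNReal.ofNat_ne_top hup.ne)))
    exact ENNReal.tendsto_pow_atTop_nhds_zero_of_lt_one (by simp)
  rw [zero_mul, add_zero] at hlim
  refine ge_of_tendsto' hlim fun K => (hK K).trans ?_
  gcongr
  · exact ENNReal.sum_le_tsum _
  · exact eLpNorm_diff_le hp _ hu

theorem eLpNorm_diff_diff_conv_le_modulus {f g : EuclideanSpace ℝ (Fin n) → ℝ} (hf : Measurable f)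
    (hg : Measurable g) {p₀ p₁ p : ℝ≥0∞} (hY : YoungTriple p₀ p₁ p)
    (hfp : eLpNorm f p₀ volume < ⊤) (hgp : eLpNorm g p₁ volume < ⊤) (σ₀ σ₁ : ℝ)
    {h k : EuclideanSpace ℝ (Fin n)} (hh : h ≠ 0) (hk : k ≠ 0) :
    eLpNorm (diff h (diff k (conv f g))) p (strictMeasure n p) ≤
      ‖h‖ₑ ^ σ₀ * ‖k‖ₑ ^ σ₁ * (modulus volume σ₀ p₀ f ‖h‖ * modulus volume σ₁ p₁ g ‖k‖) := by
  refine (eLpNorm_diff_diff_conv_le hf hg hY hfp hgp h k).trans ?_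
  rw [mul_mul_mul_comm]
  exact mul_le_mul' (eLpNorm_diff_le_rpow_mul_modulus _ _ _ _ _ hh)
    (eLpNorm_diff_le_rpow_mul_modulus _ _ _ _ _ hk)

theorem tsum_geometric_two_rpow_ne_top {τ : ℝ} (hτ : τ < 0) :
    ∑' k : ℕ, ((2 : ℝ≥0∞) ^ τ) ^ k ≠ ⊤ := by
  rw [ENNReal.tsum_geometric, ENNReal.inv_ne_top]
  exact (tsub_pos_of_lt (ENNReal.rpow_lt_one_of_one_lt_of_neg (by norm_num) hτ)).ne'

/-- Total order below one: Marchaud's inequality expresses the first differences of `f * g` by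
second differences, and the resulting series converges geometrically because `σ₀ + σ₁ < 1`. -/
theorem exists_besov_conv_le_of_add_lt_one {σ₀ σ₁ : ℝ} (h01 : σ₀ + σ₁ < 1) :
    ∃ C : ℝ≥0∞, C ≠ ⊤ ∧ ∀ (p₀ p₁ p : ℝ≥0∞), YoungTriple p₀ p₁ p →
      ∀ f g : EuclideanSpace ℝ (Fin n) → ℝ, Measurable f → Measurable g →
      eLpNorm f p₀ volume < ⊤ → eLpNorm g p₁ volume < ⊤ →
      besov (strictMeasure n p) (σ₀ + σ₁) p (conv f g) ≤
        C * (besov volume σ₀ p₀ f * besov volume σ₁ p₁ g) := by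
  set τ := σ₀ + σ₁ with hτ
  refine ⟨_, tsum_geometric_two_rpow_ne_top (sub_neg.2 h01), fun p₀ p₁ p hY f g hf hg hfp hgp => ?_⟩
  set X : ℝ → ℝ≥0∞ := fun ρ => modulus volume σ₀ p₀ f ρ * modulus volume σ₁ p₁ g ρ with hX
  have hH : eLpNorm (conv f g) p (strictMeasure n p) < ⊤ :=
    (eLpNorm_conv_le hf hg hY).trans_lt (ENNReal.mul_lt_top hfp hgp)
  have hpt (ρ : ℝ) (hρ : 0 < ρ) : modulus (strictMeasure n p) τ p (conv f g) ρ ≤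
      ∑' k : ℕ, ((2 : ℝ≥0∞) ^ (τ - 1)) ^ k * X (2 ^ (k : ℤ) * ρ) := by
    refine iSup₂_le fun h hh => ?_
    have h0 : h ≠ 0 := by
      rintro rfl
      simp at hh
      linarith
    have hz : ‖h‖ₑ ≠ 0 := by simpa using h0
    refine (mul_le_mul_right (eLpNorm_diff_le_tsum_diff_diff hY.one_le (measurable_conv hf hg)
      hH h) _).trans ?_
    rw [← ENNReal.tsum_mul_left]
    refine ENNReal.tsum_le_tsum fun k => ?_
    have hk0 : (2 : ℝ) ^ (k : ℤ) • h ≠ 0 := smul_ne_zero (by positivity) h0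
    have h1 := eLpNorm_diff_diff_conv_le_modulus hf hg hY hfp hgp σ₀ σ₁ hk0 hk0
    rw [norm_two_zpow_smul, hh, enorm_two_zpow_smul, ← ENNReal.rpow_add _ _
      (mul_ne_zero (by simp) hz) (ENNReal.mul_ne_top (by simp) enorm_ne_top), ← hτ,
      ENNReal.mul_rpow_of_ne_top (by simp) enorm_ne_top, ← ENNReal.rpow_mul] at h1
    have h2 : (2⁻¹ : ℝ≥0∞) ^ (k + 1) ≤ 2 ^ (-(k : ℝ)) := by
      rw [ENNReal.rpow_neg, ENNReal.rpow_natCast, ENNReal.inv_pow]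
      exact pow_le_pow_right_of_le_one' (a := (2⁻¹ : ℝ≥0∞)) (by simp) (Nat.le_succ k)
    calc ‖h‖ₑ ^ (-τ) * (2⁻¹ ^ (k + 1) * eLpNorm (diff ((2 : ℝ) ^ (k : ℤ) • h)
          (diff ((2 : ℝ) ^ (k : ℤ) • h) (conv f g))) p (strictMeasure n p))
        ≤ ‖h‖ₑ ^ (-τ) * (2 ^ (-(k : ℝ)) * ((2 : ℝ≥0∞) ^ (((k : ℤ) : ℝ) * τ) * ‖h‖ₑ ^ τ *
          X (2 ^ (k : ℤ) * ρ))) := by gcongr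
      _ = (‖h‖ₑ ^ (-τ) * ‖h‖ₑ ^ τ) * (2 ^ (-(k : ℝ)) * 2 ^ (((k : ℤ) : ℝ) * τ)) *
          X (2 ^ (k : ℤ) * ρ) := by ring
      _ = ((2 : ℝ≥0∞) ^ (τ - 1)) ^ k * X (2 ^ (k : ℤ) * ρ) := by
          rw [← ENNReal.rpow_add _ _ hz enorm_ne_top, ← two_rpow_add,
            ← ENNReal.rpow_natCast, ← ENNReal.rpow_mul, neg_add_cancel, ENNReal.rpow_zero, one_mul]
          congr 2
          push_cast
          ring
  refine iSup₂_le fun r hr => (ellNorm_le_of_le le_rfl hY.one_le _).trans ?_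
  rw [ellNorm_one]
  calc ∑' m : ℤ, modulus (strictMeasure n p) τ p (conv f g) (2 ^ m * r)
      ≤ ∑' m : ℤ, ∑' k : ℕ, ((2 : ℝ≥0∞) ^ (τ - 1)) ^ k * X (2 ^ (k : ℤ) * (2 ^ m * r)) :=
        ENNReal.tsum_le_tsum fun m => hpt _ (by positivity)
    _ = ∑' k : ℕ, ((2 : ℝ≥0∞) ^ (τ - 1)) ^ k * ∑' m : ℤ, X (2 ^ m * r) := by
        rw [ENNReal.tsum_comm]
        refine tsum_congr fun k => ?_
        rw [ENNReal.tsum_mul_left, ← (Equiv.addLeft (k : ℤ)).tsum_eq (fun m : ℤ => X (2 ^ m * r))]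
        congr 1
        refine tsum_congr fun m => ?_
        rw [Equiv.coe_addLeft, zpow_add₀ two_ne_zero, mul_assoc]
    _ ≤ _ := by
        rw [ENNReal.tsum_mul_right]
        gcongr
        exact tsum_modulus_mul_modulus_le hY σ₀ σ₁ f g hr hr

/-! ### Weak derivatives as limits of difference quotients -/

/-- Testing against a compactly supported continuous function is continuous on `L^p`. -/
theorem exists_enorm_integral_mul_le {φ : EuclideanSpace ℝ (Fin n) → ℝ} (hφ : Continuous φ)
    (hc : HasCompactSupport φ) {p : ℝ≥0∞} (hp : 1 ≤ p) :
    ∃ C : ℝ≥0∞, C ≠ ⊤ ∧ ∀ w : EuclideanSpace ℝ (Fin n) → ℝ, Measurable w →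
      ‖∫ x, w x * φ x‖ₑ ≤ C * eLpNorm w p volume := by
  obtain ⟨B, hB⟩ := hc.exists_bound_of_continuous hφ
  set K := tsupport φ
  have hK : IsCompact K := hc
  set c := volume.restrict K univ ^ (1 / (1 : ℝ≥0∞).toReal - 1 / p.toReal) with hcdef
  have hct : c ≠ ⊤ := by
    refine ENNReal.rpow_ne_top_of_nonneg ?_ (by simpa using hK.measure_lt_top.ne)
    simpa using ENNReal.toReal_mono (by simp) (ENNReal.inv_le_one.2 hp)
  refine ⟨ENNReal.ofReal B * c, ENNReal.mul_ne_top ENNReal.ofReal_ne_top hct, fun w hw => ?_⟩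
  have h1 := eLpNorm_le_eLpNorm_mul_rpow_measure_univ (f := w) (μ := volume.restrict K) hp
    hw.aestronglyMeasurable
  rw [eLpNorm_one_eq_lintegral_enorm, ← hcdef] at h1
  calc ‖∫ x, w x * φ x‖ₑ ≤ ∫⁻ x, ‖w x * φ x‖ₑ := enorm_integral_le_lintegral_enorm _
    _ ≤ ∫⁻ x, K.indicator (fun x => ENNReal.ofReal B * ‖w x‖ₑ) x := by
        refine lintegral_mono fun x => ?_
        by_cases hx : x ∈ K
        · rw [indicator_of_mem hx, enorm_mul, mul_comm]
          gcongr
          rw [← ofReal_norm]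
          exact ENNReal.ofReal_le_ofReal (hB x)
        · simp [image_eq_zero_of_notMem_tsupport hx]
    _ = ENNReal.ofReal B * ∫⁻ x in K, ‖w x‖ₑ := by
        rw [lintegral_indicator hK.measurableSet, lintegral_const_mul _ hw.enorm]
    _ ≤ ENNReal.ofReal B * (eLpNorm w p volume * c) := by
        gcongr
        exact h1.trans (mul_le_mul_left (eLpNorm_restrict_le w p volume K) c)
    _ = _ := by ring

/-- The dyadic difference quotient of step `2^{-m}` in the direction `e`. -/
def diffQuot (e : EuclideanSpace ℝ (Fin n)) (u : EuclideanSpace ℝ (Fin n) → ℝ) (m : ℤ) :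
    EuclideanSpace ℝ (Fin n) → ℝ :=
  (2 : ℝ) ^ m • diff ((2 : ℝ) ^ (-m) • e) u

theorem measurable_diffQuot (e : EuclideanSpace ℝ (Fin n)) {u : EuclideanSpace ℝ (Fin n) → ℝ}
    (hu : Measurable u) (m : ℤ) : Measurable (diffQuot e u m) :=
  (measurable_diff _ hu).const_smul _

/-- If the dyadic difference quotients of `u` in a coordinate direction converge in `L^p`, their
limit is the weak partial derivative. -/
theorem isWeakDeriv_of_tendsto_diffQuot {u v : EuclideanSpace ℝ (Fin n) → ℝ} (hu : Measurable u)
    (hv : Measurable v) (hul : LocallyIntegrable u volume) {p : ℝ≥0∞} (hp : 1 ≤ p)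
    (hvp : eLpNorm v p volume < ⊤) (i : Fin n)
    (h : Tendsto (fun m : ℕ => eLpNorm (diffQuot (EuclideanSpace.single i 1) u m - v) p volume)
      atTop (𝓝 0)) : IsWeakDeriv (Pi.single i 1) u v where
  locallyIntegrable_left := hul
  locallyIntegrable_right := locallyIntegrable_of_eLpNorm_lt_top hv hp hvp
  integral_eq φ hφ hc := by
    set e : EuclideanSpace ℝ (Fin n) := EuclideanSpace.single i 1 with he
    have hvl : LocallyIntegrable v volume := locallyIntegrable_of_eLpNorm_lt_top hv hp hvp
    have hint {w ψ : EuclideanSpace ℝ (Fin n) → ℝ} (hw : LocallyIntegrable w volume)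
        (hψ : Continuous ψ) (hcψ : HasCompactSupport ψ) : Integrable (fun x => w x * ψ x) volume :=
      hw.integrable_smul_right_of_hasCompactSupport hψ hcψ
    have hshift (k : EuclideanSpace ℝ (Fin n)) : HasCompactSupport fun x => φ (x - k) := by
      have := hc.comp_homeomorph (Homeomorph.subRight k)
      exact this
    have hIk' (k : EuclideanSpace ℝ (Fin n)) : Integrable (fun x => u x * φ (x - k)) volume :=
      hint hul (hφ.continuous.comp (continuous_id.sub continuous_const)) (hshift k)
    have hIk (k : EuclideanSpace ℝ (Fin n)) : Integrable (fun x => u (x + k) * φ x) volume := by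
      simpa using (hIk' k).comp_add_right k
    have hdiffint (m : ℕ) : Integrable (fun x => diffQuot e u m x * φ x) volume := by
      have := ((hIk ((2 : ℝ) ^ (-(m : ℤ)) • e)).sub (hint hul hφ.continuous hc)).const_mul
        ((2 : ℝ) ^ (m : ℤ))
      refine this.congr (Eventually.of_forall fun x => ?_)
      simp only [diffQuot, diff, Pi.smul_apply, smul_eq_mul, Pi.sub_apply]
      ring
    have hlim1 : Tendsto (fun m : ℕ => ∫ x, diffQuot e u m x * φ x) atTop (𝓝 (∫ x, v x * φ x)) := by
      obtain ⟨C, hC, H⟩ := exists_enorm_integral_mul_le hφ.continuous hc hp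
      rw [tendsto_iff_edist_tendsto_0]
      have h0 := ENNReal.Tendsto.const_mul h (Or.inr hC)
      rw [mul_zero] at h0
      refine tendsto_of_tendsto_of_tendsto_of_le_of_le tendsto_const_nhds h0
        (fun _ => zero_le) fun m => ?_
      have h1 := H (diffQuot e u m - v) ((measurable_diffQuot e hu m).sub hv)
      rw [edist_eq_enorm_sub, ← integral_sub (hdiffint m) (hint hvl hφ.continuous hc)]
      simpa only [Pi.sub_apply, sub_mul] using h1
    have hlim2 : Tendsto (fun m : ℕ => ∫ x, diffQuot e u m x * φ x) atTop
        (𝓝 (∫ x, u x * (-partialDeriv i φ x))) := by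
      have hrw (m : ℕ) : ∫ x, diffQuot e u m x * φ x =
          ∫ x, u x * ((2 : ℝ) ^ m * (φ (x + ((2 : ℝ) ^ m)⁻¹ • (-e)) - φ x)) := by
        have h1 : ∫ x, u (x + (2 : ℝ) ^ (-(m : ℤ)) • e) * φ x =
            ∫ x, u x * φ (x - (2 : ℝ) ^ (-(m : ℤ)) • e) := by
          rw [← integral_add_right_eq_self (fun x => u x * φ (x - (2 : ℝ) ^ (-(m : ℤ)) • e))
            ((2 : ℝ) ^ (-(m : ℤ)) • e)]
          simp
        have h2 : ∫ x, diffQuot e u m x * φ x = (2 : ℝ) ^ m *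
            ((∫ x, u (x + (2 : ℝ) ^ (-(m : ℤ)) • e) * φ x) - ∫ x, u x * φ x) := by
          rw [← integral_sub (hIk _) (hint hul hφ.continuous hc), ← integral_const_mul]
          refine integral_congr_ae (Eventually.of_forall fun x => ?_)
          simp only [diffQuot, diff, Pi.smul_apply, smul_eq_mul, zpow_natCast]
          ring
        rw [h2, h1, ← integral_sub (hIk' _) (hint hul hφ.continuous hc),
          ← integral_const_mul]
        refine integral_congr_ae (Eventually.of_forall fun x => ?_)
        simp only [zpow_neg, zpow_natCast, smul_neg, sub_eq_add_neg]
        ring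
      simp_rw [hrw]
      obtain ⟨L, hL⟩ := ContDiff.lipschitzWith_of_hasCompactSupport hc hφ (by simp)
      set K := Metric.cthickening 1 (tsupport φ)
      have hK : IsCompact K := IsCompact.cthickening hc
      have hne : ‖e‖ = 1 := by simp [he]
      refine tendsto_integral_of_dominated_convergence
        (K.indicator fun x => ‖u x‖ * L) (fun m => ?_) ?_ (fun m => ?_) ?_
      · exact (hu.mul (measurable_const.mul ((hφ.continuous.measurable.comp
          (measurable_add_const _)).sub hφ.continuous.measurable))).aestronglyMeasurable
      · rw [integrable_indicator_iff hK.measurableSet]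
        exact ((hul.integrableOn_isCompact hK).norm).mul_const _
      · refine Eventually.of_forall fun x => ?_
        have h2m : (0 : ℝ) < 2 ^ m := by positivity
        have hst : ‖((2 : ℝ) ^ m)⁻¹ • (-e)‖ = ((2 : ℝ) ^ m)⁻¹ := by
          rw [norm_smul, norm_neg, hne, mul_one, Real.norm_eq_abs, abs_of_pos (by positivity)]
        by_cases hx : x ∈ K
        · rw [indicator_of_mem hx, norm_mul]
          gcongr
          have h3 := hL.dist_le_mul (x + ((2 : ℝ) ^ m)⁻¹ • (-e)) x
          rw [dist_eq_norm, dist_eq_norm, add_sub_cancel_left, hst] at h3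
          rw [norm_mul, Real.norm_eq_abs, abs_of_pos h2m]
          calc (2 : ℝ) ^ m * ‖φ (x + ((2 : ℝ) ^ m)⁻¹ • (-e)) - φ x‖
              ≤ 2 ^ m * (L * ((2 : ℝ) ^ m)⁻¹) := by gcongr
            _ = L := by field_simp
        · have h4 : φ x = 0 := by
            refine image_eq_zero_of_notMem_tsupport fun hx' => hx ?_
            exact Metric.self_subset_cthickening _ hx'
          have h5 : φ (x + ((2 : ℝ) ^ m)⁻¹ • (-e)) = 0 := by
            refine image_eq_zero_of_notMem_tsupport fun hx' => hx ?_
            refine Metric.mem_cthickening_of_dist_le x _ 1 _ hx' ?_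
            rw [dist_comm, dist_eq_norm, add_sub_cancel_left, hst]
            exact inv_le_one_of_one_le₀ (one_le_pow₀ (by norm_num))
          rw [indicator_of_notMem hx, h4, h5]
          simp
      · refine Eventually.of_forall fun x => Tendsto.const_mul _ ?_
        have hd := ((hφ.differentiable (by simp)) x).hasFDerivAt
        have h6 := hd.lim (-e) (c := fun m : ℕ => (2 : ℝ) ^ m) (l := atTop) (by
          simp only [norm_pow, Real.norm_ofNat]
          exact tendsto_pow_atTop_atTop_of_one_lt (by norm_num))
        rw [map_neg] at h6
        exact h6
    have := tendsto_nhds_unique hlim1 hlim2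
    rw [multiDeriv_single, order_single, this, ← integral_const_mul]
    refine integral_congr_ae (Eventually.of_forall fun x => ?_)
    simp

/-- Completeness of `L^p` for a sequence indexed by all integers: if consecutive distances are
summable, there is a limit, at a distance from each term at most the remaining sum. -/
theorem exists_eLpNorm_sub_le_tsum {μ : Measure (EuclideanSpace ℝ (Fin n))} {p : ℝ≥0∞}
    (hp : 1 ≤ p) {D : ℤ → EuclideanSpace ℝ (Fin n) → ℝ} (hD : ∀ m, MemLp (D m) p μ)
    {δ : ℤ → ℝ≥0∞} (hδ : ∀ m, eLpNorm (D (m + 1) - D m) p μ ≤ δ m)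
    (hsum : ∑' k : ℕ, δ k ≠ ⊤) :
    ∃ v : EuclideanSpace ℝ (Fin n) → ℝ, Measurable v ∧
      ∀ m : ℤ, eLpNorm (D m - v) p μ ≤ ∑' k : ℕ, δ (m + k) := by
  have : Fact (1 ≤ p) := ⟨hp⟩
  set F : ℤ → Lp ℝ p μ := fun m => (hD m).toLp (D m)
  have hF (m : ℤ) : edist (F m) (F (m + 1)) ≤ δ m := by
    rw [edist_comm, Lp.edist_toLp_toLp]
    exact hδ m
  have hc : CauchySeq fun k : ℕ => F k :=
    cauchySeq_of_edist_le_of_tsum_ne_top (fun k : ℕ => δ k)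
      (fun k => by simpa using hF k) hsum
  obtain ⟨v, hv⟩ := cauchySeq_tendsto_of_complete hc
  refine ⟨v, (Lp.stronglyMeasurable v).measurable, fun m => ?_⟩
  have hvZ : Tendsto F atTop (𝓝 v) := by
    rw [← Nat.map_cast_int_atTop, tendsto_map'_iff]
    exact hv
  have hvm : Tendsto (fun k : ℕ => F (m + k)) atTop (𝓝 v) :=
    hvZ.comp (tendsto_atTop_add_const_left _ m tendsto_natCast_atTop_atTop)
  have h := edist_le_tsum_of_edist_le_of_tendsto₀ (fun k : ℕ => δ (m + k))
    (fun k => by simpa [add_assoc] using hF (m + k)) hvm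
  rw [Nat.cast_zero, add_zero, Lp.edist_def] at h
  refine le_trans (le_of_eq (eLpNorm_congr_ae ?_)) h
  filter_upwards [(hD m).coeFn_toLp] with x hx
  simp only [Pi.sub_apply]
  rw [hx]

theorem diffQuot_add_one_sub (e : EuclideanSpace ℝ (Fin n)) (u : EuclideanSpace ℝ (Fin n) → ℝ)
    (m : ℤ) : diffQuot e u (m + 1) - diffQuot e u m = -(2 : ℝ) ^ m •
      diff ((2 : ℝ) ^ (-(m + 1)) • e) (diff ((2 : ℝ) ^ (-(m + 1)) • e) u) := by
  have h1 : (2 : ℝ) ^ (-m) • e = (2 : ℝ) ^ (-(m + 1)) • e + (2 : ℝ) ^ (-(m + 1)) • e := by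
    rw [← add_smul, ← two_mul, ← zpow_one_add₀ two_ne_zero]
    congr 2
    ring
  ext x
  simp only [diffQuot, diff, Pi.sub_apply, Pi.smul_apply, smul_eq_mul]
  rw [h1, zpow_add_one₀ two_ne_zero, ← add_assoc]
  ring

theorem diff_const_smul (h : EuclideanSpace ℝ (Fin n)) (c : ℝ)
    (u : EuclideanSpace ℝ (Fin n) → ℝ) : diff h (c • u) = c • diff h u := by
  ext x
  simp only [diff, Pi.smul_apply, smul_eq_mul]
  ring

theorem ellNorm_comp_add {p : ℝ≥0∞} (hp : 1 ≤ p) (t : ℤ → ℝ≥0∞) (j : ℤ) :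
    ellNorm p (fun m => t (m + j)) = ellNorm p t := by
  rcases eq_or_ne p ⊤ with rfl | hpt
  · rw [ellNorm_top, ellNorm_top]
    exact (Equiv.addRight j).iSup_comp (g := t)
  · rw [ellNorm_eq_tsum hp hpt, ellNorm_eq_tsum hp hpt]
    congr 1
    exact (Equiv.addRight j).tsum_eq (fun m => t m ^ p.toReal)

/-- By dyadic scaling, only base radii in `[1, 2)` matter. -/
theorem besov_le_of_forall_mem_Ico {μ : Measure (EuclideanSpace ℝ (Fin n))} {σ : ℝ} {p : ℝ≥0∞}
    (hp : 1 ≤ p) {u : EuclideanSpace ℝ (Fin n) → ℝ} {B : ℝ≥0∞}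
    (h : ∀ r ∈ Ico (1 : ℝ) 2, ellNorm p (fun m : ℤ => modulus μ σ p u (2 ^ m * r)) ≤ B) :
    besov μ σ p u ≤ B := by
  refine iSup₂_le fun r hr => ?_
  obtain ⟨j, hj1, hj2⟩ := exists_mem_Ico_zpow hr (one_lt_two : (1 : ℝ) < 2)
  have h2j : (0 : ℝ) < 2 ^ j := by positivity
  rw [zpow_add_one₀ two_ne_zero] at hj2
  have h1 := h (r / 2 ^ j) ⟨(one_le_div h2j).2 hj1, by rw [div_lt_iff₀ h2j]; linarith⟩
  rw [← ellNorm_comp_add hp _ j] at h1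
  refine le_trans (le_of_eq ?_) h1
  congr 1
  ext m
  rw [zpow_add₀ two_ne_zero]
  congr 1
  field_simp

/-- If the smoothness orders of `f` and `g` add up to at least one, then the difference quotients
of `f * g` converge: consecutive dyadic difference quotients differ by second differences of
`f * g`, which are convolutions of first differences of `f` and `g`. -/
theorem exists_weakDeriv_conv {σ₀ σ₁ τ : ℝ} (hτ : σ₀ + σ₁ = 1 + τ) (hτ0 : 0 ≤ τ)
    {p₀ p₁ p : ℝ≥0∞} (hY : YoungTriple p₀ p₁ p) {f g : EuclideanSpace ℝ (Fin n) → ℝ}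
    (hf : Measurable f) (hg : Measurable g) (hfp : eLpNorm f p₀ volume < ⊤)
    (hgp : eLpNorm g p₁ volume < ⊤) (hfB : besov volume σ₀ p₀ f < ⊤)
    (hgB : besov volume σ₁ p₁ g < ⊤) (i : Fin n) :
    ∃ v : EuclideanSpace ℝ (Fin n) → ℝ, Measurable v ∧
      IsWeakDeriv (Pi.single i 1) (conv f g) v ∧
      eLpNorm v p volume ≤ 2 * (eLpNorm f p₀ volume * eLpNorm g p₁ volume) +
        besov volume σ₀ p₀ f * besov volume σ₁ p₁ g ∧
      ∀ m : ℤ, eLpNorm (diffQuot (EuclideanSpace.single i 1) (conv f g) m - v) p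
        (strictMeasure n p) ≤ ∑' k : ℕ, (2 : ℝ≥0∞) ^ (-((m + k + 1 : ℤ) : ℝ) * τ) *
          (modulus volume σ₀ p₀ f (2 ^ (-(m + k + 1 : ℤ))) *
            modulus volume σ₁ p₁ g (2 ^ (-(m + k + 1 : ℤ)))) := by
  set e : EuclideanSpace ℝ (Fin n) := EuclideanSpace.single i 1 with he
  have hne : ‖e‖ = 1 := by simp [he]
  have hne' : ‖e‖ₑ = 1 := by rw [← ofReal_norm, hne, ENNReal.ofReal_one]
  have he0 : e ≠ 0 := by
    intro h
    simp [h] at hne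
  set μ := strictMeasure n p with hμ
  set H := conv f g with hHdef
  have hHm : Measurable H := measurable_conv hf hg
  have hHp : eLpNorm H p μ ≤ eLpNorm f p₀ volume * eLpNorm g p₁ volume := eLpNorm_conv_le hf hg hY
  have hHt : eLpNorm H p μ < ⊤ := hHp.trans_lt (ENNReal.mul_lt_top hfp hgp)
  set X : ℤ → ℝ≥0∞ := fun j => modulus volume σ₀ p₀ f (2 ^ j) * modulus volume σ₁ p₁ g (2 ^ j)
    with hX
  have hXsum : ∑' j : ℤ, X j ≤ besov volume σ₀ p₀ f * besov volume σ₁ p₁ g := by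
    simpa only [mul_one] using tsum_modulus_mul_modulus_le hY σ₀ σ₁ f g one_pos one_pos
  set δ : ℤ → ℝ≥0∞ := fun m => (2 : ℝ≥0∞) ^ (-((m + 1 : ℤ) : ℝ) * τ) * X (-(m + 1)) with hδdef
  have hD (m : ℤ) : MemLp (diffQuot e H m) p μ := by
    refine ⟨(measurable_diffQuot e hHm m).aestronglyMeasurable, ?_⟩
    rw [diffQuot, eLpNorm_const_smul]
    exact ENNReal.mul_lt_top enorm_lt_top ((eLpNorm_diff_le hY.one_le _ hHm).trans_lt
      (ENNReal.mul_lt_top ENNReal.ofNat_lt_top hHt))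
  have hδ (m : ℤ) : eLpNorm (diffQuot e H (m + 1) - diffQuot e H m) p μ ≤ δ m := by
    have hk0 : (2 : ℝ) ^ (-(m + 1)) • e ≠ 0 := smul_ne_zero (by positivity) he0
    have h1 := eLpNorm_diff_diff_conv_le_modulus hf hg hY hfp hgp σ₀ σ₁ hk0 hk0
    rw [norm_two_zpow_smul, hne, mul_one, enorm_two_zpow_smul, hne', mul_one,
      ← ENNReal.rpow_mul, ← ENNReal.rpow_mul, ← two_rpow_add, ← mul_add, hτ] at h1
    rw [diffQuot_add_one_sub, eLpNorm_const_smul, enorm_neg, enorm_two_zpow]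
    refine (mul_le_mul_right h1 _).trans ?_
    rw [← mul_assoc, ← two_rpow_add, hδdef]
    refine mul_le_mul_left (ENNReal.rpow_le_rpow_of_exponent_le (by norm_num) ?_) _
    push_cast
    linarith
  have hδX : ∑' k : ℕ, δ k ≤ besov volume σ₀ p₀ f * besov volume σ₁ p₁ g := by
    refine le_trans ?_ hXsum
    have hinj : Function.Injective fun k : ℕ => (-((k : ℤ) + 1)) := by
      intro a b hab
      simpa using hab
    refine le_trans ?_ (ENNReal.tsum_comp_le_tsum_of_injective hinj X)
    refine ENNReal.tsum_le_tsum fun k => ?_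
    refine mul_le_of_le_one_left zero_le ?_
    refine (ENNReal.rpow_le_rpow_of_exponent_le (y := -((((k : ℤ) + 1 : ℤ) : ℝ)) * τ) (z := 0)
      (by norm_num) ?_).trans_eq ENNReal.rpow_zero
    push_cast
    nlinarith [(Nat.cast_nonneg k : (0 : ℝ) ≤ k)]
  have hδt : ∑' k : ℕ, δ k ≠ ⊤ := (hδX.trans_lt (ENNReal.mul_lt_top hfB hgB)).ne
  obtain ⟨v, hv, hvD⟩ := exists_eLpNorm_sub_le_tsum hY.one_le hD hδ hδt
  have hvp : eLpNorm v p μ ≤ 2 * (eLpNorm f p₀ volume * eLpNorm g p₁ volume) +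
      besov volume σ₀ p₀ f * besov volume σ₁ p₁ g := by
    have h0 : diffQuot e H 0 = diff e H := by simp [diffQuot]
    have h1 : v = diff e H - (diffQuot e H 0 - v) := by rw [h0]; abel
    rw [h1]
    refine (eLpNorm_sub_le (measurable_diff e hHm).aestronglyMeasurable
      ((measurable_diffQuot e hHm 0).sub hv).aestronglyMeasurable hY.one_le).trans ?_
    refine add_le_add ((eLpNorm_diff_le hY.one_le e hHm).trans (mul_le_mul_right hHp _)) ?_
    refine ((hvD 0).trans (le_of_eq ?_)).trans hδX
    simp only [zero_add]
  have hvol := eLpNorm_volume_le_strictMeasure v p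
  refine ⟨v, hv, ?_, hvol.trans hvp, fun m => ?_⟩
  · refine isWeakDeriv_of_tendsto_diffQuot hHm hv (locallyIntegrable_conv hf hg hY hfp hgp)
      hY.one_le ((hvol.trans hvp).trans_lt ?_) i ?_
    · exact ENNReal.add_lt_top.2 ⟨ENNReal.mul_lt_top ENNReal.ofNat_lt_top
        (ENNReal.mul_lt_top hfp hgp), ENNReal.mul_lt_top hfB hgB⟩
    · refine tendsto_of_tendsto_of_tendsto_of_le_of_le tendsto_const_nhds
        (ENNReal.tendsto_sum_nat_add _ hδt) (fun _ => zero_le) fun m => ?_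
      refine (eLpNorm_volume_le_strictMeasure _ p).trans ((hvD m).trans (le_of_eq ?_))
      refine tsum_congr fun k => ?_
      push_cast
      rw [add_comm]
  · refine (hvD m).trans (le_of_eq (tsum_congr fun k => ?_))
    simp only [hδdef, hX]

/-- If the smoothness orders add up to `1 + τ` with `τ > 0`, the derivative of `f * g` has
smoothness `τ`: a difference of step `h` of the derivative is compared with that of the difference
quotient whose step is the power of two next to `|h|`, and the latter is a second difference of
`f * g`. -/
theorem exists_weakDeriv_conv_besov_le {σ₀ σ₁ τ : ℝ} (hσ₀ : 0 ≤ σ₀) (hτ : σ₀ + σ₁ = 1 + τ)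
    (hτ0 : 0 < τ) : ∃ C : ℝ≥0∞, C ≠ ⊤ ∧ ∀ (p₀ p₁ p : ℝ≥0∞), YoungTriple p₀ p₁ p →
      ∀ f g : EuclideanSpace ℝ (Fin n) → ℝ, Measurable f → Measurable g →
      eLpNorm f p₀ volume < ⊤ → eLpNorm g p₁ volume < ⊤ → besov volume σ₀ p₀ f < ⊤ →
      besov volume σ₁ p₁ g < ⊤ → ∀ i : Fin n,
    ∃ v : EuclideanSpace ℝ (Fin n) → ℝ, Measurable v ∧
      IsWeakDeriv (Pi.single i 1) (conv f g) v ∧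
      eLpNorm v p volume ≤ 2 * (eLpNorm f p₀ volume * eLpNorm g p₁ volume) +
        besov volume σ₀ p₀ f * besov volume σ₁ p₁ g ∧
      besov (strictMeasure n p) τ p v ≤ C * (besov volume σ₀ p₀ f * besov volume σ₁ p₁ g) := by
  set G : ℝ≥0∞ := ∑' k : ℕ, ((2 : ℝ≥0∞) ^ (-τ)) ^ k with hG
  have hGt : G ≠ ⊤ := tsum_geometric_two_rpow_ne_top (neg_lt_zero.2 hτ0)
  refine ⟨2 * G + 2 ^ σ₀, ENNReal.add_ne_top.2 ⟨ENNReal.mul_ne_top ENNReal.ofNat_ne_top hGt,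
    ENNReal.rpow_ne_top_of_nonneg hσ₀ ENNReal.ofNat_ne_top⟩,
    fun p₀ p₁ p hY f g hf hg hfp hgp hfB hgB i => ?_⟩
  obtain ⟨v, hv, hw, hvp, hvD⟩ := exists_weakDeriv_conv hτ hτ0.le hY hf hg hfp hgp hfB hgB i
  refine ⟨v, hv, hw, hvp, besov_le_of_forall_mem_Ico hY.one_le fun r hr => ?_⟩
  set e : EuclideanSpace ℝ (Fin n) := EuclideanSpace.single i 1 with he
  have hne : ‖e‖ = 1 := by simp [he]
  have hne' : ‖e‖ₑ = 1 := by rw [← ofReal_norm, hne, ENNReal.ofReal_one]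
  have he0 : e ≠ 0 := by
    intro h
    simp [h] at hne
  set μ := strictMeasure n p with hμ
  set H := conv f g with hHdef
  have hHm : Measurable H := measurable_conv hf hg
  set X : ℤ → ℝ≥0∞ := fun j => modulus volume σ₀ p₀ f (2 ^ j) * modulus volume σ₁ p₁ g (2 ^ j)
    with hX
  -- the terms from differences of `f` of step `h` and of `g` of step `2 ^ m`, whose radii differ by
  -- the factor `r`
  set Y : ℤ → ℝ≥0∞ := fun j => modulus volume σ₀ p₀ f (2 ^ j * r) *
    modulus volume σ₁ p₁ g (2 ^ j) with hYdef
  have hXsum : ∑' j : ℤ, X j ≤ besov volume σ₀ p₀ f * besov volume σ₁ p₁ g := by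
    simpa only [mul_one] using tsum_modulus_mul_modulus_le hY σ₀ σ₁ f g one_pos one_pos
  have hYsum : ∑' j : ℤ, Y j ≤ besov volume σ₀ p₀ f * besov volume σ₁ p₁ g := by
    simpa only [mul_one] using tsum_modulus_mul_modulus_le hY σ₀ σ₁ f g
      (one_pos.trans_le hr.1) one_pos
  have hr0 : 0 < r := one_pos.trans_le hr.1
  -- `h` has length between `2 ^ m` and `2 ^ (m + 1)`: compare with the difference quotient of
  -- step `2 ^ m`
  have hpt (m : ℤ) : modulus μ τ p v (2 ^ m * r) ≤
      2 * ∑' k : ℕ, ((2 : ℝ≥0∞) ^ (-τ)) ^ k * X (m - k - 1) + 2 ^ σ₀ * Y m := by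
    refine iSup₂_le fun h hh => ?_
    have hh0 : h ≠ 0 := by
      rintro rfl
      rw [norm_zero] at hh
      have : (0 : ℝ) < 2 ^ m * r := by positivity
      linarith
    have hnorm : ‖h‖ₑ = (2 : ℝ≥0∞) ^ (m : ℝ) * ENNReal.ofReal r := by
      rw [← ofReal_norm, hh, ENNReal.ofReal_mul (by positivity), ← enorm_two_zpow, ← ofReal_norm,
        Real.norm_eq_abs, abs_of_pos (by positivity)]
    have hr1 : 1 ≤ ENNReal.ofReal r := ENNReal.one_le_ofReal.2 hr.1
    have hr2 : ENNReal.ofReal r ≤ 2 := by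
      rw [← ENNReal.ofReal_ofNat]
      exact ENNReal.ofReal_le_ofReal hr.2.le
    have hinv : ‖h‖ₑ ^ (-τ) ≤ (2 : ℝ≥0∞) ^ (-((m : ℝ) * τ)) := by
      rw [ENNReal.rpow_neg, ENNReal.rpow_neg, ENNReal.inv_le_inv, hnorm, ENNReal.rpow_mul]
      exact ENNReal.rpow_le_rpow (le_mul_of_one_le_right zero_le hr1) hτ0.le
    have hpow : ‖h‖ₑ ^ σ₀ ≤ (2 : ℝ≥0∞) ^ ((m : ℝ) * σ₀) * 2 ^ σ₀ := by
      rw [hnorm, ENNReal.mul_rpow_of_nonneg _ _ hσ₀, ← ENNReal.rpow_mul]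
      gcongr
    set S := diffQuot e H (-m) with hS
    have hSm : Measurable S := measurable_diffQuot e hHm _
    have hdec : diff h v = diff h S - diff h (S - v) := by
      ext x
      simp only [diff, Pi.sub_apply]
      ring
    have hfirst : eLpNorm (diff h (S - v)) p μ ≤
        2 * ∑' k : ℕ, (2 : ℝ≥0∞) ^ ((m - k - 1 : ℝ) * τ) * X (m - k - 1) := by
      refine (eLpNorm_diff_le hY.one_le h (hSm.sub hv)).trans (mul_le_mul_right ?_ _)
      refine (hvD (-m)).trans (le_of_eq (tsum_congr fun k => ?_))
      rw [show (-(-m + (k : ℤ) + 1)) = m - k - 1 by ring]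
      congr 2
      push_cast
      ring
    have hsecond : eLpNorm (diff h S) p μ ≤
        (2 : ℝ≥0∞) ^ ((m : ℝ) * τ) * (2 ^ σ₀ * Y m) := by
      have hk0 : (2 : ℝ) ^ m • e ≠ 0 := smul_ne_zero (by positivity) he0
      have h1 := eLpNorm_diff_diff_conv_le_modulus hf hg hY hfp hgp σ₀ σ₁ hh0 hk0
      rw [norm_two_zpow_smul, hne, mul_one, enorm_two_zpow_smul, hne', mul_one, hh,
        ← ENNReal.rpow_mul] at h1
      rw [hS, diffQuot, diff_const_smul, eLpNorm_const_smul, enorm_two_zpow, neg_neg]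
      calc (2 : ℝ≥0∞) ^ ((-m : ℤ) : ℝ) * eLpNorm (diff h (diff ((2 : ℝ) ^ m • e) H)) p μ
          ≤ (2 : ℝ≥0∞) ^ ((-m : ℤ) : ℝ) * ((2 ^ ((m : ℝ) * σ₀) * 2 ^ σ₀) *
            2 ^ ((m : ℝ) * σ₁) * Y m) := by
            gcongr
            exact h1.trans (by gcongr)
        _ = ((2 : ℝ≥0∞) ^ ((-m : ℤ) : ℝ) * 2 ^ ((m : ℝ) * σ₀) * 2 ^ ((m : ℝ) * σ₁)) *
            (2 ^ σ₀ * Y m) := by ring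
        _ = _ := by
            rw [← two_rpow_add, ← two_rpow_add]
            congr 2
            push_cast
            linear_combination (m : ℝ) * hτ
    calc ‖h‖ₑ ^ (-τ) * eLpNorm (diff h v) p μ
        ≤ (2 : ℝ≥0∞) ^ (-((m : ℝ) * τ)) * ((2 : ℝ≥0∞) ^ ((m : ℝ) * τ) * (2 ^ σ₀ * Y m) +
          2 * ∑' k : ℕ, (2 : ℝ≥0∞) ^ ((m - k - 1 : ℝ) * τ) * X (m - k - 1)) := by
          refine mul_le_mul' hinv ?_
          rw [hdec]
          exact (eLpNorm_sub_le (measurable_diff h hSm).aestronglyMeasurable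
            (measurable_diff h (hSm.sub hv)).aestronglyMeasurable hY.one_le).trans
            (add_le_add hsecond hfirst)
      _ = 2 * ∑' k : ℕ, (2 : ℝ≥0∞) ^ (-(k + 1 : ℝ) * τ) * X (m - k - 1) + 2 ^ σ₀ * Y m := by
          rw [mul_add, ← mul_assoc, ← two_rpow_add, neg_add_cancel, ENNReal.rpow_zero,
            one_mul, mul_left_comm ((2 : ℝ≥0∞) ^ (-((m : ℝ) * τ))) 2, ← ENNReal.tsum_mul_left,
            add_comm (2 ^ σ₀ * Y m)]
          refine congrArg (fun t => 2 * t + 2 ^ σ₀ * Y m) (tsum_congr fun k => ?_)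
          rw [← mul_assoc, ← two_rpow_add]
          congr 2
          ring
      _ ≤ _ := by
          gcongr with k
          rw [← ENNReal.rpow_natCast, ← ENNReal.rpow_mul]
          refine ENNReal.rpow_le_rpow_of_exponent_le (by norm_num) ?_
          nlinarith
  refine (ellNorm_le_of_le le_rfl hY.one_le _).trans ?_
  rw [ellNorm_one]
  calc ∑' m : ℤ, modulus μ τ p v (2 ^ m * r)
      ≤ ∑' m : ℤ, (2 * ∑' k : ℕ, ((2 : ℝ≥0∞) ^ (-τ)) ^ k * X (m - k - 1) + 2 ^ σ₀ * Y m) :=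
        ENNReal.tsum_le_tsum hpt
    _ = 2 * ∑' k : ℕ, ((2 : ℝ≥0∞) ^ (-τ)) ^ k * ∑' m : ℤ, X m + 2 ^ σ₀ * ∑' m : ℤ, Y m := by
        rw [ENNReal.tsum_add, ENNReal.tsum_mul_left, ENNReal.tsum_mul_left, ENNReal.tsum_comm]
        congr 2
        refine tsum_congr fun k => ?_
        rw [ENNReal.tsum_mul_left, ← (Equiv.subRight ((k : ℤ) + 1)).tsum_eq X]
        congr 1
        refine tsum_congr fun m => ?_
        rw [Equiv.subRight_apply, sub_sub]
    _ ≤ 2 * (G * (besov volume σ₀ p₀ f * besov volume σ₁ p₁ g)) +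
        2 ^ σ₀ * (besov volume σ₀ p₀ f * besov volume σ₁ p₁ g) := by
        rw [ENNReal.tsum_mul_right]
        gcongr
    _ = _ := by ring

/-! ### Slobodeckij norms and bounds on weak derivatives -/

theorem derivLpNorm_le_sobolevNorm {k : ℕ} {p : ℝ≥0∞} (hp : 1 ≤ p) {α : Fin n → ℕ}
    (hα : order α ≤ k) (u : EuclideanSpace ℝ (Fin n) → ℝ) :
    derivLpNorm α p u ≤ sobolevNorm k p u := by
  have hmem := mem_multiIndices.2 hα
  rw [sobolevNorm]
  split_ifs with hpt
  · rw [hpt]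
    exact le_iSup₂_of_le α hmem le_rfl
  · have hp0 : 0 < p.toReal := zero_lt_one.trans_le (one_le_toReal hp hpt)
    rw [one_div, ENNReal.le_rpow_inv_iff hp0]
    exact Finset.single_le_sum (f := fun α => derivLpNorm α p u ^ p.toReal)
      (fun _ _ => zero_le) hmem

theorem sobolevNorm_le_slobodeckijNorm (s : ℝ) {p : ℝ≥0∞} (hp : 1 ≤ p)
    (u : EuclideanSpace ℝ (Fin n) → ℝ) : sobolevNorm ⌊s⌋₊ p u ≤ slobodeckijNorm s p u := by
  rw [slobodeckijNorm]
  split_ifs with hs hpt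
  · exact le_rfl
  · exact le_max_left _ _
  · have hp0 : 0 < p.toReal := zero_lt_one.trans_le (one_le_toReal hp hpt)
    rw [one_div, ENNReal.le_rpow_inv_iff hp0]
    exact le_self_add

theorem derivGagliardoSeminorm_le_slobodeckijNorm {s : ℝ} (hs : s ≠ ⌊s⌋₊) {p : ℝ≥0∞}
    (hp : 1 ≤ p) {α : Fin n → ℕ} (hα : order α = ⌊s⌋₊) (u : EuclideanSpace ℝ (Fin n) → ℝ) :
    derivGagliardoSeminorm α (s - ⌊s⌋₊) p u ≤ slobodeckijNorm s p u := by
  have h : derivGagliardoSeminorm α (s - ⌊s⌋₊) p u ≤ slobodeckijSeminorm s p u :=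
    le_iSup₂_of_le α hα le_rfl
  refine h.trans ?_
  rw [slobodeckijNorm, if_neg hs]
  split_ifs with hpt
  · exact le_max_right _ _
  · have hp0 : 0 < p.toReal := zero_lt_one.trans_le (one_le_toReal hp hpt)
    rw [one_div, ENNReal.le_rpow_inv_iff hp0]
    exact le_add_self

theorem exists_sobolevNorm_le (n k : ℕ) {p : ℝ≥0∞} (hp : 1 ≤ p) : ∃ C : ℝ≥0∞, C ≠ ⊤ ∧
    ∀ (u : EuclideanSpace ℝ (Fin n) → ℝ) (N : ℝ≥0∞),
      (∀ α : Fin n → ℕ, order α ≤ k → derivLpNorm α p u ≤ N) → sobolevNorm k p u ≤ C * N := by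
  by_cases hpt : p = ⊤
  · refine ⟨1, ENNReal.one_ne_top, fun u N h => ?_⟩
    rw [sobolevNorm, if_pos hpt, one_mul, ← hpt]
    exact iSup₂_le fun α hα => h α (mem_multiIndices.1 hα)
  · have hp0 : 0 < p.toReal := zero_lt_one.trans_le (one_le_toReal hp hpt)
    refine ⟨((multiIndices n k).card : ℝ≥0∞) ^ (1 / p.toReal),
      ENNReal.rpow_ne_top_of_nonneg (by positivity) (by simp), fun u N h => ?_⟩
    rw [sobolevNorm, if_neg hpt]
    calc (∑ α ∈ multiIndices n k, derivLpNorm α p u ^ p.toReal) ^ (1 / p.toReal)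
        ≤ (∑ _ ∈ multiIndices n k, N ^ p.toReal) ^ (1 / p.toReal) := by
          refine ENNReal.rpow_le_rpow (Finset.sum_le_sum fun α hα => ?_) (by positivity)
          exact ENNReal.rpow_le_rpow (h α (mem_multiIndices.1 hα)) hp0.le
      _ = _ := by
          rw [Finset.sum_const, nsmul_eq_mul, ENNReal.mul_rpow_of_nonneg _ _ (by positivity),
            ← ENNReal.rpow_mul, mul_one_div_cancel hp0.ne', ENNReal.rpow_one]

/-- The weak derivatives of `u` of order at most `k` exist and are bounded by `N` in `L^p`, and, if
`σ ≠ 0`, those of order `k` have dyadic seminorms of order `σ` bounded by `N`. -/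
def WeakDerivBound (μ : Measure (EuclideanSpace ℝ (Fin n))) (k : ℕ) (σ : ℝ) (p : ℝ≥0∞)
    (u : EuclideanSpace ℝ (Fin n) → ℝ) (N : ℝ≥0∞) : Prop :=
  ∀ α : Fin n → ℕ, order α ≤ k → ∃ v : EuclideanSpace ℝ (Fin n) → ℝ, Measurable v ∧
    IsWeakDeriv α u v ∧ eLpNorm v p volume ≤ N ∧ (order α = k → σ ≠ 0 → besov μ σ p v ≤ N)

theorem fract_mem_Ico {s : ℝ} (hs : 0 ≤ s) : s - ⌊s⌋₊ ∈ Ico (0 : ℝ) 1 :=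
  ⟨sub_nonneg.2 (Nat.floor_le hs), by linarith [Nat.lt_floor_add_one s]⟩

/-- A Slobodeckij function has measurable representatives of all its weak derivatives with the
bounds needed for the estimates. No continuity is asked of them even if `p = ∞`. -/
theorem exists_weakDerivBound (n : ℕ) {s : ℝ} (hs : 0 ≤ s) {p : ℝ≥0∞} (hp : 1 ≤ p) :
    ∃ C : ℝ≥0∞, C ≠ ⊤ ∧ ∀ f : EuclideanSpace ℝ (Fin n) → ℝ, MemSlobodeckij s p f →
      ∃ f' : EuclideanSpace ℝ (Fin n) → ℝ, Measurable f' ∧ f =ᵐ[volume] f' ∧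
        WeakDerivBound volume ⌊s⌋₊ (s - ⌊s⌋₊) p f' (C * slobodeckijNorm s p f) := by
  obtain ⟨C, hC, H⟩ : ∃ C : ℝ≥0∞, C ≠ ⊤ ∧ (s - ⌊s⌋₊ ≠ 0 → ∀ (α : Fin n → ℕ)
      (u v : EuclideanSpace ℝ (Fin n) → ℝ), IsWeakDeriv α u v →
      besov volume (s - ⌊s⌋₊) p v ≤ C * derivGagliardoSeminorm α (s - ⌊s⌋₊) p u) := by
    by_cases h0 : s - ⌊s⌋₊ = 0
    · exact ⟨0, ENNReal.zero_ne_top, fun h => absurd h0 h⟩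
    · obtain ⟨C, hC, H⟩ := exists_besov_le_derivGagliardoSeminorm n
        (lt_of_le_of_ne (fract_mem_Ico hs).1 (Ne.symm h0)) (fract_mem_Ico hs).2 hp
      exact ⟨C, hC, fun _ => H⟩
  refine ⟨C + 1, by simp [hC], fun f hf => ?_⟩
  have hderiv (α : Fin n → ℕ) (hα : order α ≤ ⌊s⌋₊) :
      ∃ v : EuclideanSpace ℝ (Fin n) → ℝ, Measurable v ∧ IsWeakDeriv α f v ∧
        eLpNorm v p volume ≤ slobodeckijNorm s p f := by
    have hle := (derivLpNorm_le_sobolevNorm hp hα f).trans (sobolevNorm_le_slobodeckijNorm s hp f)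
    obtain ⟨v, hv, -⟩ := by
      simpa only [derivLpNorm, iInf_lt_iff] using hle.trans_lt hf
    have hm := hv.locallyIntegrable_right.aestronglyMeasurable
    have hv' := hv.congr_right hm.ae_eq_mk
    exact ⟨hm.mk v, hm.stronglyMeasurable_mk.measurable, hv', by rwa [← derivLpNorm_eq p hv']⟩
  obtain ⟨f', hf'm, hf', -⟩ := hderiv 0 (by simp [order_zero])
  have hff' : f =ᵐ[volume] f' := (isWeakDeriv_zero hf'.locallyIntegrable_left).ae_eq hf'
  refine ⟨f', hf'm, hff', fun α hα => ?_⟩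
  obtain ⟨v, hvm, hv, hvp⟩ := hderiv α hα
  refine ⟨v, hvm, hv.congr_left hff', hvp.trans ?_, fun hα' h0 => ?_⟩
  · rw [add_mul, one_mul]
    exact le_add_self
  · refine (H h0 α f v hv).trans (mul_le_mul' le_self_add ?_)
    exact derivGagliardoSeminorm_le_slobodeckijNorm (sub_ne_zero.1 h0) hp hα' f

/-- Conversely, the bounds taken with `strictMeasure` give a finite norm. -/
theorem exists_slobodeckijNorm_le (n : ℕ) (s : ℝ) {p : ℝ≥0∞} (hp : 1 ≤ p) :
    ∃ C : ℝ≥0∞, C ≠ ⊤ ∧ ∀ (u : EuclideanSpace ℝ (Fin n) → ℝ) (N : ℝ≥0∞),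
      WeakDerivBound (strictMeasure n p) ⌊s⌋₊ (s - ⌊s⌋₊) p u N → slobodeckijNorm s p u ≤ C * N := by
  obtain ⟨C₁, hC₁, H₁⟩ := exists_sobolevNorm_le n ⌊s⌋₊ hp
  obtain ⟨C₂, hC₂, H₂⟩ := exists_gagliardoSeminorm_le_besov n (s - ⌊s⌋₊) hp
  refine ⟨C₁ + C₂, ENNReal.add_ne_top.2 ⟨hC₁, hC₂⟩, fun u N h => ?_⟩
  have hS : sobolevNorm ⌊s⌋₊ p u ≤ C₁ * N := H₁ u N fun α hα => by
    obtain ⟨v, -, hv, hvp, -⟩ := h α hα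
    rwa [derivLpNorm_eq p hv]
  have hG (h0 : s ≠ ⌊s⌋₊) : slobodeckijSeminorm s p u ≤ C₂ * N := by
    refine iSup₂_le fun α hα => ?_
    obtain ⟨v, hvm, hv, -, hB⟩ := h α hα.le
    exact (iInf₂_le v hv).trans
      ((H₂ v hvm).trans (mul_le_mul_right (hB hα (sub_ne_zero.2 h0)) _))
  rw [slobodeckijNorm, add_mul]
  split_ifs with hs hpt
  · exact hS.trans le_self_add
  · exact max_le (hS.trans le_self_add) ((hG hs).trans le_add_self)
  · exact (ENNReal.rpow_add_rpow_le_add _ _ (one_le_toReal hp hpt)).trans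
      (add_le_add hS (hG hs))

/-! ### The convolution of two Slobodeckij functions -/

section

variable {p₀ p₁ p : ℝ≥0∞} {k₀ k₁ : ℕ} {σ₀ σ₁ σ : ℝ} {f g : EuclideanSpace ℝ (Fin n) → ℝ}
  {N₀ N₁ : ℝ≥0∞}

theorem WeakDerivBound.eLpNorm_lt_top {μ : Measure (EuclideanSpace ℝ (Fin n))}
    (h : WeakDerivBound μ k₀ σ₀ p₀ f N₀) (hN : N₀ < ⊤) : eLpNorm f p₀ volume < ⊤ := by
  obtain ⟨v, -, hv, hvp, -⟩ := h 0 (by simp [order_zero])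
  rw [eLpNorm_congr_ae ((isWeakDeriv_zero hv.locallyIntegrable_left).ae_eq hv)]
  exact hvp.trans_lt hN

/-- A derivative `D^{α+β}(f * g)` of order at most `k₀ + k₁` is `D^α f * D^β g`. -/
theorem WeakDerivBound.exists_conv (hY : YoungTriple p₀ p₁ p) (hf : Measurable f)
    (hg : Measurable g) (hN₀ : N₀ < ⊤) (hN₁ : N₁ < ⊤)
    (hfB : WeakDerivBound volume k₀ σ₀ p₀ f N₀) (hgB : WeakDerivBound volume k₁ σ₁ p₁ g N₁)
    {γ : Fin n → ℕ} (hγ : order γ ≤ k₀ + k₁) :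
    ∃ F G : EuclideanSpace ℝ (Fin n) → ℝ, Measurable F ∧ Measurable G ∧
      IsWeakDeriv γ (conv f g) (conv F G) ∧ eLpNorm F p₀ volume ≤ N₀ ∧ eLpNorm G p₁ volume ≤ N₁ ∧
      (order γ = k₀ + k₁ → (σ₀ ≠ 0 → besov volume σ₀ p₀ F ≤ N₀) ∧
        (σ₁ ≠ 0 → besov volume σ₁ p₁ G ≤ N₁)) := by
  obtain ⟨α, β, rfl, hα, hβ⟩ := exists_add_of_order_le hγ
  obtain ⟨F, hFm, hF, hFp, hFB⟩ := hfB α hα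
  obtain ⟨G, hGm, hG, hGp, hGB⟩ := hgB β hβ
  refine ⟨F, G, hFm, hGm, hF.conv hG hf hFm hg hGm hY (hfB.eLpNorm_lt_top hN₀)
    (hFp.trans_lt hN₀) (hgB.eLpNorm_lt_top hN₁) (hGp.trans_lt hN₁), hFp, hGp, fun h => ?_⟩
  rw [order_add] at h
  exact ⟨hFB (by omega), hGB (by omega)⟩

/-- If the fractional parts add up to less than one, the derivatives of top order of `f * g` are
convolutions `F * G` of derivatives of `f` and `g` of top order, and the bound for their seminorms
is the hypothesis `hstep`. -/
theorem weakDerivBound_conv (hY : YoungTriple p₀ p₁ p) {C : ℝ≥0∞}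
    (hstep : ∀ F G : EuclideanSpace ℝ (Fin n) → ℝ, Measurable F → Measurable G →
      eLpNorm F p₀ volume ≤ N₀ → eLpNorm G p₁ volume ≤ N₁ →
      (σ₀ ≠ 0 → besov volume σ₀ p₀ F ≤ N₀) → (σ₁ ≠ 0 → besov volume σ₁ p₁ G ≤ N₁) → σ ≠ 0 →
      besov (strictMeasure n p) σ p (conv F G) ≤ C * (N₀ * N₁))
    (hf : Measurable f) (hg : Measurable g) (hN₀ : N₀ < ⊤) (hN₁ : N₁ < ⊤)
    (hfB : WeakDerivBound volume k₀ σ₀ p₀ f N₀) (hgB : WeakDerivBound volume k₁ σ₁ p₁ g N₁) :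
    WeakDerivBound (strictMeasure n p) (k₀ + k₁) σ p (conv f g) ((C + 1) * (N₀ * N₁)) := by
  intro γ hγ
  obtain ⟨F, G, hFm, hGm, hw, hFp, hGp, hB⟩ := hfB.exists_conv hY hf hg hN₀ hN₁ hgB hγ
  refine ⟨conv F G, measurable_conv hFm hGm, hw, ?_, fun h h0 => ?_⟩
  · refine ((eLpNorm_volume_le_strictMeasure _ p).trans (eLpNorm_conv_le hFm hGm hY)).trans ?_
    rw [add_mul, one_mul]
    exact (mul_le_mul' hFp hGp).trans le_add_self
  · exact (hstep F G hFm hGm hFp hGp (hB h).1 (hB h).2 h0).trans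
      (mul_le_mul_left le_self_add _)

theorem exists_single_of_order_eq_one {β : Fin n → ℕ} (h : order β = 1) :
    ∃ i, β = Pi.single i 1 := by
  obtain ⟨i, hi⟩ : ∃ i, β i ≠ 0 := by
    by_contra! hc
    simp [order, hc] at h
  refine ⟨i, funext fun j => ?_⟩
  have h1 := Finset.add_sum_erase Finset.univ β (Finset.mem_univ i)
  rw [show ∑ j, β j = 1 from h] at h1
  rcases eq_or_ne j i with rfl | hj
  · rw [Pi.single_eq_same]
    omega
  · have h2 := Finset.single_le_sum (f := β) (fun _ _ => Nat.zero_le _)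
      (Finset.mem_erase.2 ⟨hj, Finset.mem_univ j⟩)
    rw [Pi.single_eq_of_ne hj]
    omega

/-- If the fractional parts add up to at least one, `f * g` has one derivative more than `f` and `g`
together: a derivative of top order is a first-order derivative `∂ᵢ (F * G)`, provided by the
hypothesis `hstep`. -/
theorem weakDerivBound_conv_succ (hY : YoungTriple p₀ p₁ p) {C : ℝ≥0∞}
    (hstep : ∀ F G : EuclideanSpace ℝ (Fin n) → ℝ, Measurable F → Measurable G →
      eLpNorm F p₀ volume ≤ N₀ → eLpNorm G p₁ volume ≤ N₁ →
      (σ₀ ≠ 0 → besov volume σ₀ p₀ F ≤ N₀) → (σ₁ ≠ 0 → besov volume σ₁ p₁ G ≤ N₁) →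
      ∀ i : Fin n, ∃ v : EuclideanSpace ℝ (Fin n) → ℝ, Measurable v ∧
        IsWeakDeriv (Pi.single i 1) (conv F G) v ∧ eLpNorm v p volume ≤ C * (N₀ * N₁) ∧
        (σ ≠ 0 → besov (strictMeasure n p) σ p v ≤ C * (N₀ * N₁)))
    (hf : Measurable f) (hg : Measurable g) (hN₀ : N₀ < ⊤) (hN₁ : N₁ < ⊤)
    (hfB : WeakDerivBound volume k₀ σ₀ p₀ f N₀) (hgB : WeakDerivBound volume k₁ σ₁ p₁ g N₁) :
    WeakDerivBound (strictMeasure n p) (k₀ + k₁ + 1) σ p (conv f g) ((C + 1) * (N₀ * N₁)) := by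
  intro γ hγ
  rcases Nat.lt_or_ge (k₀ + k₁) (order γ) with hlt | hge
  · obtain ⟨γ', β, rfl, hγ', hβ⟩ := exists_add_of_order_eq (k := k₀ + k₁) (l := 1)
      (le_antisymm hγ hlt)
    obtain ⟨i, rfl⟩ := exists_single_of_order_eq_one hβ
    obtain ⟨F, G, hFm, hGm, hw, hFp, hGp, hB⟩ := hfB.exists_conv hY hf hg hN₀ hN₁ hgB hγ'.le
    obtain ⟨v, hvm, hv, hvp, hvB⟩ := hstep F G hFm hGm hFp hGp (hB hγ').1 (hB hγ').2 i
    exact ⟨v, hvm, hw.trans hv, hvp.trans (mul_le_mul_left le_self_add _),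
      fun _ h0 => (hvB h0).trans (mul_le_mul_left le_self_add _)⟩
  · obtain ⟨F, G, hFm, hGm, hw, hFp, hGp, -⟩ := hfB.exists_conv hY hf hg hN₀ hN₁ hgB hge
    refine ⟨conv F G, measurable_conv hFm hGm, hw, ?_, fun h => by omega⟩
    refine ((eLpNorm_volume_le_strictMeasure _ p).trans (eLpNorm_conv_le hFm hGm hY)).trans ?_
    rw [add_mul, one_mul]
    exact (mul_le_mul' hFp hGp).trans le_add_self

end

/-- The estimate for the convolution, split according to whether the fractional parts of the two
orders add up to at least one and whether one of them vanishes. -/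
theorem exists_weakDerivBound_conv (n : ℕ) {s₀ s₁ : ℝ} (hs₀ : 0 ≤ s₀) (hs₁ : 0 ≤ s₁)
    {p₀ p₁ p : ℝ≥0∞} (hY : YoungTriple p₀ p₁ p) : ∃ C : ℝ≥0∞, C ≠ ⊤ ∧
      ∀ (f g : EuclideanSpace ℝ (Fin n) → ℝ) (N₀ N₁ : ℝ≥0∞), Measurable f → Measurable g →
        N₀ < ⊤ → N₁ < ⊤ → WeakDerivBound volume ⌊s₀⌋₊ (s₀ - ⌊s₀⌋₊) p₀ f N₀ →
        WeakDerivBound volume ⌊s₁⌋₊ (s₁ - ⌊s₁⌋₊) p₁ g N₁ →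
        WeakDerivBound (strictMeasure n p) ⌊s₀ + s₁⌋₊ (s₀ + s₁ - ⌊s₀ + s₁⌋₊) p (conv f g)
          (C * (N₀ * N₁)) := by
  have h₀ := fract_mem_Ico hs₀
  have h₁ := fract_mem_Ico hs₁
  set σ₀ := s₀ - ⌊s₀⌋₊ with hσ₀
  set σ₁ := s₁ - ⌊s₁⌋₊ with hσ₁
  rcases lt_or_ge (σ₀ + σ₁) 1 with hlt | hge
  · have hfloor : ⌊s₀ + s₁⌋₊ = ⌊s₀⌋₊ + ⌊s₁⌋₊ := by
      rw [Nat.floor_eq_iff (by positivity)]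
      push_cast
      constructor <;> linarith [h₀.1, h₁.1]
    have hfr : s₀ + s₁ - ⌊s₀ + s₁⌋₊ = σ₀ + σ₁ := by
      rw [hfloor]
      push_cast
      ring
    rw [hfr, hfloor]
    -- the seminorm of order `0` is not available if a fractional part vanishes
    by_cases hz₀ : σ₀ = 0
    · refine ⟨1 + 1, by simp, fun f g N₀ N₁ hf hg hN₀ hN₁ hfB hgB => ?_⟩
      refine weakDerivBound_conv hY (fun F G hF hG hFp hGp _ hGB h0 => ?_) hf hg hN₀ hN₁ hfB hgB
      rw [hz₀, zero_add] at h0 ⊢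
      rw [one_mul, conv_comm, mul_comm]
      exact (besov_conv_le_mul_eLpNorm hG hF hY.symm (hGp.trans_lt hN₁) (hFp.trans_lt hN₀) _).trans
        (mul_le_mul' (hGB h0) hFp)
    by_cases hz₁ : σ₁ = 0
    · refine ⟨1 + 1, by simp, fun f g N₀ N₁ hf hg hN₀ hN₁ hfB hgB => ?_⟩
      refine weakDerivBound_conv hY (fun F G hF hG hFp hGp hFB _ h0 => ?_) hf hg hN₀ hN₁ hfB hgB
      rw [hz₁, add_zero] at h0 ⊢
      rw [one_mul]
      exact (besov_conv_le_mul_eLpNorm hF hG hY (hFp.trans_lt hN₀) (hGp.trans_lt hN₁) _).trans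
        (mul_le_mul' (hFB h0) hGp)
    obtain ⟨C, hC, H⟩ := exists_besov_conv_le_of_add_lt_one (n := n) hlt
    refine ⟨C + 1, by simp [hC], fun f g N₀ N₁ hf hg hN₀ hN₁ hfB hgB => ?_⟩
    refine weakDerivBound_conv hY (fun F G hF hG hFp hGp hFB hGB _ => ?_) hf hg hN₀ hN₁ hfB hgB
    exact (H p₀ p₁ p hY F G hF hG (hFp.trans_lt hN₀) (hGp.trans_lt hN₁)).trans
      (mul_le_mul_right (mul_le_mul' (hFB hz₀) (hGB hz₁)) _)
  · have hfloor : ⌊s₀ + s₁⌋₊ = ⌊s₀⌋₊ + ⌊s₁⌋₊ + 1 := by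
      rw [Nat.floor_eq_iff (by positivity)]
      push_cast
      constructor <;> linarith [h₀.2, h₁.2]
    have hfr : s₀ + s₁ - ⌊s₀ + s₁⌋₊ = σ₀ + σ₁ - 1 := by
      rw [hfloor]
      push_cast
      ring
    rw [hfr, hfloor]
    -- the sum can only reach `1` if neither fractional part vanishes
    have hz₀ : σ₀ ≠ 0 := by
      intro h
      linarith [h₁.2]
    have hz₁ : σ₁ ≠ 0 := by
      intro h
      linarith [h₀.2]
    set τ := σ₀ + σ₁ - 1 with hτdef
    have hτ : σ₀ + σ₁ = 1 + τ := by ring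
    obtain ⟨C, hC, H⟩ : ∃ C : ℝ≥0∞, C ≠ ⊤ ∧ (τ ≠ 0 → ∀ (p₀ p₁ p : ℝ≥0∞), YoungTriple p₀ p₁ p →
        ∀ f g : EuclideanSpace ℝ (Fin n) → ℝ, Measurable f → Measurable g →
        eLpNorm f p₀ volume < ⊤ → eLpNorm g p₁ volume < ⊤ → besov volume σ₀ p₀ f < ⊤ →
        besov volume σ₁ p₁ g < ⊤ → ∀ i : Fin n,
        ∃ v : EuclideanSpace ℝ (Fin n) → ℝ, Measurable v ∧
          IsWeakDeriv (Pi.single i 1) (conv f g) v ∧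
          eLpNorm v p volume ≤ 2 * (eLpNorm f p₀ volume * eLpNorm g p₁ volume) +
            besov volume σ₀ p₀ f * besov volume σ₁ p₁ g ∧
          besov (strictMeasure n p) τ p v ≤
            C * (besov volume σ₀ p₀ f * besov volume σ₁ p₁ g)) := by
      by_cases hτz : τ = 0
      · exact ⟨0, ENNReal.zero_ne_top, fun h => absurd hτz h⟩
      · obtain ⟨C, hC, H⟩ := exists_weakDeriv_conv_besov_le (n := n) h₀.1 hτ
          (lt_of_le_of_ne (sub_nonneg.2 hge) (Ne.symm hτz))
        exact ⟨C, hC, fun _ => H⟩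
    refine ⟨C + 3 + 1, by simp [hC], fun f g N₀ N₁ hf hg hN₀ hN₁ hfB hgB => ?_⟩
    refine weakDerivBound_conv_succ hY (fun F G hF hG hFp hGp hFB hGB i => ?_) hf hg hN₀ hN₁
      hfB hgB
    have hF' := hFp.trans_lt hN₀
    have hG' := hGp.trans_lt hN₁
    have hFB' := (hFB hz₀).trans_lt hN₀
    have hGB' := (hGB hz₁).trans_lt hN₁
    have hbound : 2 * (eLpNorm F p₀ volume * eLpNorm G p₁ volume) +
        besov volume σ₀ p₀ F * besov volume σ₁ p₁ G ≤ (C + 3) * (N₀ * N₁) := by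
      calc 2 * (eLpNorm F p₀ volume * eLpNorm G p₁ volume) +
            besov volume σ₀ p₀ F * besov volume σ₁ p₁ G
          ≤ 2 * (N₀ * N₁) + N₀ * N₁ :=
            add_le_add (mul_le_mul_right (mul_le_mul' hFp hGp) _)
              (mul_le_mul' (hFB hz₀) (hGB hz₁))
        _ = 3 * (N₀ * N₁) := by ring
        _ ≤ (C + 3) * (N₀ * N₁) := mul_le_mul_left le_add_self _
    by_cases hτz : τ = 0
    · obtain ⟨v, hvm, hv, hvp, -⟩ := exists_weakDeriv_conv hτ (sub_nonneg.2 hge) hY hF hG hF' hG'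
        hFB' hGB' i
      exact ⟨v, hvm, hv, hvp.trans hbound, fun h => absurd hτz h⟩
    · obtain ⟨v, hvm, hv, hvp, hvB⟩ := H hτz p₀ p₁ p hY F G hF hG hF' hG' hFB' hGB' i
      refine ⟨v, hvm, hv, hvp.trans hbound, fun _ => hvB.trans ?_⟩
      exact mul_le_mul' le_self_add (mul_le_mul' (hFB hz₀) (hGB hz₁))

end SobolevSlobodeckij

end

theorem mainTheorem6 (n : ℕ) (hn : 1 ≤ n) (s₀ s₁ : ℝ) (hs₀ : 0 ≤ s₀) (hs₁ : 0 ≤ s₁)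
    (p₀ p₁ p : ℝ≥0∞) (hp₀ : 1 ≤ p₀) (hp₁ : 1 ≤ p₁) (hp : 1 ≤ p)
    (hpp : p⁻¹ + 1 = p₀⁻¹ + p₁⁻¹) :
    ∃ C : ℝ≥0, ∀ f g : EuclideanSpace ℝ (Fin n) → ℝ,
      SobolevSlobodeckij.MemSlobodeckij s₀ p₀ f → SobolevSlobodeckij.MemSlobodeckij s₁ p₁ g →
        (∀ᵐ x, ConvolutionExistsAt f g x (ContinuousLinearMap.mul ℝ ℝ) volume) ∧
        SobolevSlobodeckij.MemSlobodeckij (s₀ + s₁) p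
          (f ⋆[ContinuousLinearMap.mul ℝ ℝ, volume] g) ∧
        SobolevSlobodeckij.slobodeckijNorm (s₀ + s₁) p
            (f ⋆[ContinuousLinearMap.mul ℝ ℝ, volume] g) ≤
          C * SobolevSlobodeckij.slobodeckijNorm s₀ p₀ f *
            SobolevSlobodeckij.slobodeckijNorm s₁ p₁ g := by
  have hY : SobolevSlobodeckij.YoungTriple p₀ p₁ p := ⟨hp₀, hp₁, hp, hpp⟩
  obtain ⟨A₀, hA₀, H₀⟩ := SobolevSlobodeckij.exists_weakDerivBound n hs₀ hp₀
  obtain ⟨A₁, hA₁, H₁⟩ := SobolevSlobodeckij.exists_weakDerivBound n hs₁ hp₁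
  obtain ⟨B, hB, HB⟩ := SobolevSlobodeckij.exists_weakDerivBound_conv n hs₀ hs₁ hY
  obtain ⟨D, hD, HD⟩ := SobolevSlobodeckij.exists_slobodeckijNorm_le n (s₀ + s₁) hp
  have hC : D * B * A₀ * A₁ ≠ ⊤ :=
    ENNReal.mul_ne_top (ENNReal.mul_ne_top (ENNReal.mul_ne_top hD hB) hA₀) hA₁
  refine ⟨(D * B * A₀ * A₁).toNNReal, fun f g hf hg => ?_⟩
  rw [ENNReal.coe_toNNReal hC]
  obtain ⟨f', hf'm, hff', hf'B⟩ := H₀ f hf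
  obtain ⟨g', hg'm, hgg', hg'B⟩ := H₁ g hg
  have hN₀ : A₀ * SobolevSlobodeckij.slobodeckijNorm s₀ p₀ f < ⊤ :=
    ENNReal.mul_lt_top hA₀.lt_top hf
  have hN₁ : A₁ * SobolevSlobodeckij.slobodeckijNorm s₁ p₁ g < ⊤ :=
    ENNReal.mul_lt_top hA₁.lt_top hg
  have hconv : (f ⋆[ContinuousLinearMap.mul ℝ ℝ, volume] g) = SobolevSlobodeckij.conv f' g' :=
    SobolevSlobodeckij.conv_congr hff' hgg'
  have hle : SobolevSlobodeckij.slobodeckijNorm (s₀ + s₁) p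
      (f ⋆[ContinuousLinearMap.mul ℝ ℝ, volume] g) ≤
        D * B * A₀ * A₁ * SobolevSlobodeckij.slobodeckijNorm s₀ p₀ f *
          SobolevSlobodeckij.slobodeckijNorm s₁ p₁ g := by
    rw [hconv]
    exact (HD _ _ (HB f' g' _ _ hf'm hg'm hN₀ hN₁ hf'B hg'B)).trans (le_of_eq (by ring))
  refine ⟨?_, ?_, hle⟩
  · have h := SobolevSlobodeckij.ae_convolutionExistsAt hf'm hg'm hY
      (hf'B.eLpNorm_lt_top hN₀) (hg'B.eLpNorm_lt_top hN₁)
    filter_upwards [(SobolevSlobodeckij.volume_absolutelyContinuous_strictMeasure p).ae_le h]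
      with x hx
    exact SobolevSlobodeckij.convolutionExistsAt_congr hff' hgg' hx
  · exact hle.trans_lt (ENNReal.mul_lt_top (ENNReal.mul_lt_top hC.lt_top hf) hg)
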